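/- Let $n, r$ be integers with $1\le r\le n-1$ and let $\mathbf r=(i_1,\dots,i_r)$ be integers with $1\le i_1<i_2<\cdots<i_r\le n-1$; put $i_0=0$ and $i_{r+1}=n$. Let $F^n_{\mathbf r}$ be the flag manifold of all $\xi=(F_1,\dots,F_r)$, where $F_1\subset\cdots\subset F_r$ are linear subspaces of $\mathbb R^n$ with $\dim F_j=i_j$, equipped with its unique $SO_n$-invariant Borel probability measure $d\xi$. For a compact set $L\subset\mathbb R^n$ define the $\mathbf r$-flag quermassintegral and the dual $\mathbf r$-flag quermassintegral by $$\Phi_{\mathbf r}(L)=\Bigl(\int_{F^n_{\mathbf r}}\prod_{j=1}^r |P_{F_j}L|^{\,i_{j-1}-i_{j+1}}\,d\xi\Bigr)^{-\frac1{i_r n}},\qquad \Psi_{\mathbf r}(L)=\Bigl(\int_{F^n_{\mathbf r}}\prod_{j=1}^r |L\cap F_j|^{\,i_{j+1}-i_{j-1}}\,d\xi\Bigr)^{\frac1{i_r n}},$$ where $P_F$ is the orthogonal projection onto $F$ and $|\cdot|$ is $i_j$-dimensional Lebesgue measure in $F_j$; both take values in $[0,\infty]$, with $0^{-1}=\infty$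 and $\infty^{-1}=0$. **Theorem 1.1.** For every compact set $L\subset\mathbb R^n$, every volume-preserving affine map $A:\mathbb R^n\to\mathbb R^n$ and every $T\in SL_n(\mathbb R)$, $$\Phi_{\mathbf r}(AL)=\Phi_{\mathbf r}(L)\qquad\text{and}\qquad \Psi_{\mathbf r}(TL)=\Psi_{\mathbf r}(L).$$ -/

import Mathlib

open MeasureTheory
open scoped ENNReal

namespace FlagQuermass

/-- Euclidean space `ℝⁿ`. -/
abbrev Euc (n : ℕ) : Type := EuclideanSpace ℝ (Fin n)

/-- The rotation group `SOₙ`, with the topology and group structure inherited from matrices. -/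
abbrev SO (n : ℕ) : Type := Matrix.specialOrthogonalGroup (Fin n) ℝ

/-- A strictly increasing sequence `1 ≤ i₁ < i₂ < ⋯ < i_r ≤ n - 1` of integers; here `idx j` is
`i_{j+1}` because `Fin r` starts at `0`. -/
structure FlagType (n r : ℕ) where
  idx : Fin r → ℕ
  strictMono : StrictMono idx
  one_le : ∀ j, 1 ≤ idx j
  lt : ∀ j, idx j < n

/-- The sequence `i₀, i₁, …, i_r, i_{r+1}` with the convention `i₀ = 0` and `i_{r+1} = n`. -/
def FlagType.seq {n r : ℕ} (p : FlagType n r) : ℕ → ℕ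
  | 0 => 0
  | k + 1 => if h : k < r then p.idx ⟨k, h⟩ else n

/-- The flag manifold: all partial flags `F₁ ⊂ F₂ ⊂ ⋯ ⊂ F_r` of linear subspaces of `ℝⁿ` with
`dim F_j = i_j`. -/
@[ext]
structure Flag {n r : ℕ} (p : FlagType n r) where
  space : Fin r → Submodule ℝ (Euc n)
  mono : Monotone space
  finrank_eq : ∀ j, Module.finrank ℝ (space j) = p.idx j

/-- The tuple of orthogonal projections onto the members of a flag. -/
noncomputable def Flag.proj {n r : ℕ} {p : FlagType n r} (ξ : Flag p) :
    Fin r → (Euc n →L[ℝ] Euc n) :=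
  fun j => (ξ.space j).starProjection

/-- The usual topology of the flag manifold: a flag is identified with the tuple of orthogonal
projections onto its members. -/
noncomputable instance {n r : ℕ} (p : FlagType n r) : TopologicalSpace (Flag p) :=
  TopologicalSpace.induced Flag.proj inferInstance

noncomputable instance {n r : ℕ} (p : FlagType n r) : MeasurableSpace (Flag p) := borel _

instance {n r : ℕ} (p : FlagType n r) : BorelSpace (Flag p) := ⟨rfl⟩

/-! ### The rotation group as a compact topological group -/

instance (n : ℕ) : IsTopologicalGroup (SO n) where
  continuous_inv :=
    Continuous.subtype_mk (f := fun g : SO n => star (g : Matrix (Fin n) (Fin n) ℝ))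
      (continuous_star.comp continuous_subtype_val) _

instance (n : ℕ) : CompactSpace (SO n) := by
  suffices h : IsCompact ((Matrix.specialOrthogonalGroup (Fin n) ℝ : Submonoid _) :
      Set (Matrix (Fin n) (Fin n) ℝ)) from isCompact_iff_compactSpace.1 h
  have hK : IsCompact (Set.univ.pi fun _ : Fin n => Set.univ.pi fun _ : Fin n =>
      Metric.closedBall (0 : ℝ) 1) :=
    isCompact_univ_pi fun _ => isCompact_univ_pi fun _ => isCompact_closedBall _ _
  refine IsCompact.of_isClosed_subset (X := Matrix (Fin n) (Fin n) ℝ) hK ?_ ?_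
  · have : ((Matrix.specialOrthogonalGroup (Fin n) ℝ : Submonoid _) :
        Set (Matrix (Fin n) (Fin n) ℝ)) = {A | A * A.transpose = 1} ∩ {A | A.det = 1} := by
      ext A
      simp only [SetLike.mem_coe, Matrix.mem_specialOrthogonalGroup_iff,
        Matrix.mem_orthogonalGroup_iff]
      rfl
    rw [this]
    exact (isClosed_eq (by fun_prop) continuous_const).inter
      (isClosed_eq (Continuous.matrix_det continuous_id) continuous_const)
  · intro A hA i _ j _
    simpa using entry_norm_bound_of_unitary (𝕜 := ℝ) hA.1 i j

instance (n : ℕ) : MeasurableSpace (SO n) := borel _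

instance (n : ℕ) : BorelSpace (SO n) := ⟨rfl⟩

/-- The Haar probability measure on `SOₙ`. -/
noncomputable def haarSO (n : ℕ) : Measure (SO n) := Measure.haarMeasure ⊤

/-! ### The action of rotations on flags -/

/-- The linear map of `ℝⁿ` given by a rotation matrix. -/
noncomputable def rotMap {n : ℕ} (g : SO n) : Euc n →L[ℝ] Euc n :=
  Matrix.toEuclideanCLM (𝕜 := ℝ) (g : Matrix (Fin n) (Fin n) ℝ)

theorem rotMap_mul {n : ℕ} (g h : SO n) : rotMap (g * h) = rotMap g * rotMap h := by
  simp [rotMap]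

theorem rotMap_one {n : ℕ} : rotMap (1 : SO n) = 1 := by
  simp [rotMap]

theorem rotMap_inv_apply {n : ℕ} (g : SO n) (x : Euc n) : rotMap g⁻¹ (rotMap g x) = x := by
  have h := congrArg (fun f => f x) (rotMap_mul g⁻¹ g)
  simpa [rotMap_one] using h.symm

theorem rotMap_apply_inv {n : ℕ} (g : SO n) (x : Euc n) : rotMap g (rotMap g⁻¹ x) = x := by
  simpa using rotMap_inv_apply g⁻¹ x

theorem inner_rotMap {n : ℕ} (g : SO n) (x y : Euc n) :
    inner ℝ (rotMap g x) y = inner ℝ x (rotMap g⁻¹ y) := by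
  have : rotMap g⁻¹ = star (rotMap g) := by
    rw [rotMap, rotMap, ← map_star]
    rfl
  rw [this, ContinuousLinearMap.star_eq_adjoint, ContinuousLinearMap.adjoint_inner_right]

theorem continuous_rotMap {n : ℕ} : Continuous (rotMap : SO n → _) :=
  (LinearMap.continuous_of_finiteDimensional
    ((Matrix.toEuclideanCLM (𝕜 := ℝ) (n := Fin n)).toAlgEquiv.toLinearMap)).comp
    continuous_subtype_val

theorem rotMap_injective {n : ℕ} (g : SO n) : Function.Injective (rotMap g) :=
  Function.LeftInverse.injective (rotMap_inv_apply g)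

/-- The rotated flag `g F₁ ⊂ g F₂ ⊂ ⋯ ⊂ g F_r`. -/
noncomputable def Flag.rotate {n r : ℕ} {p : FlagType n r} (g : SO n) (ξ : Flag p) : Flag p where
  space j := (ξ.space j).map (rotMap g).toLinearMap
  mono _ _ h := Submodule.map_mono (ξ.mono h)
  finrank_eq j := by
    rw [← ξ.finrank_eq j]
    exact (LinearEquiv.finrank_eq
      (Submodule.equivMapOfInjective (rotMap g).toLinearMap (rotMap_injective g) (ξ.space j))).symm

/-- The coordinate flag with `F_j = span {e₁, …, e_{i_j}}`. -/
noncomputable def Flag.standard {n r : ℕ} (p : FlagType n r) : Flag p where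
  space j := Submodule.span ℝ
    (Set.range fun k : {k : Fin n // (k : ℕ) < p.idx j} => EuclideanSpace.single k.1 (1 : ℝ))
  mono j k h := by
    refine Submodule.span_mono ?_
    rintro _ ⟨l, rfl⟩
    exact ⟨⟨l.1, l.2.trans_le (p.strictMono.monotone h)⟩, rfl⟩
  finrank_eq j := by
    have hli : LinearIndependent ℝ
        fun k : {k : Fin n // (k : ℕ) < p.idx j} => EuclideanSpace.single k.1 (1 : ℝ) := by
      have h := (EuclideanSpace.basisFun (Fin n) ℝ).toBasis.linearIndependent.comp
        (fun k : {k : Fin n // (k : ℕ) < p.idx j} => k.1) Subtype.val_injective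
      have e : (⇑(EuclideanSpace.basisFun (Fin n) ℝ).toBasis ∘
          fun k : {k : Fin n // (k : ℕ) < p.idx j} => k.1) =
          fun k => EuclideanSpace.single k.1 (1 : ℝ) := by
        funext k
        simp
      rwa [e] at h
    rw [finrank_span_eq_card hli]
    rw [Fintype.card_subtype]
    have := Fin.card_filter_val_lt (n := n) (m := p.idx j)
    rw [this]
    exact min_eq_right (p.lt j).le

theorem Flag.rotate_mul {n r : ℕ} {p : FlagType n r} (g h : SO n) (ξ : Flag p) :
    ξ.rotate (g * h) = (ξ.rotate h).rotate g := by
  ext j : 2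
  simp only [Flag.rotate, rotMap_mul]
  exact Submodule.map_comp (rotMap h).toLinearMap (rotMap g).toLinearMap (ξ.space j)

theorem starProjection_rotate {n : ℕ} (g : SO n) (U : Submodule ℝ (Euc n)) :
    (U.map (rotMap g).toLinearMap).starProjection = rotMap g * U.starProjection * rotMap g⁻¹ := by
  ext1 x
  apply Submodule.eq_starProjection_of_mem_of_inner_eq_zero
  · exact ⟨_, Submodule.starProjection_apply_mem U (rotMap g⁻¹ x), rfl⟩
  · rintro _ ⟨w, hw, rfl⟩
    have h : x - (rotMap g * U.starProjection * rotMap g⁻¹) x =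
        rotMap g (rotMap g⁻¹ x - U.starProjection (rotMap g⁻¹ x)) := by
      rw [map_sub, rotMap_apply_inv]
      rfl
    rw [h, inner_rotMap]
    change inner ℝ _ (rotMap g⁻¹ (rotMap g w)) = 0
    rw [rotMap_inv_apply]
    exact Submodule.starProjection_inner_eq_zero _ _ hw

theorem Flag.continuous_orbit {n r : ℕ} {p : FlagType n r} (ξ : Flag p) :
    Continuous fun g : SO n => ξ.rotate g := by
  refine continuous_induced_rng.2 (continuous_pi fun j => ?_)
  simp only [Function.comp_def, Flag.proj, Flag.rotate, starProjection_rotate]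
  exact (continuous_rotMap.mul continuous_const).mul (continuous_rotMap.comp continuous_inv)

theorem Flag.continuous_rotate {n r : ℕ} {p : FlagType n r} (g : SO n) :
    Continuous fun ξ : Flag p => ξ.rotate g := by
  refine continuous_induced_rng.2 (continuous_pi fun j => ?_)
  simp only [Function.comp_def, Flag.proj, Flag.rotate, starProjection_rotate]
  exact (continuous_const.mul
    ((continuous_apply j).comp (continuous_induced_dom (f := Flag.proj (p := p))))).mul
    continuous_const

/-- The rotation-invariant probability measure on the flag manifold: the law of `g ξ₀`, where `ξ₀`
is the coordinate flag and `g` is a Haar distributed rotation. -/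
noncomputable def flagMeasure {n r : ℕ} (p : FlagType n r) : Measure (Flag p) :=
  (haarSO n).map fun g => (Flag.standard p).rotate g

instance (n : ℕ) : IsProbabilityMeasure (haarSO n) :=
  ⟨Measure.haarMeasure_self (K₀ := (⊤ : TopologicalSpace.PositiveCompacts (SO n)))⟩

instance {n r : ℕ} (p : FlagType n r) : IsProbabilityMeasure (flagMeasure p) :=
  Measure.isProbabilityMeasure_map (Flag.standard p).continuous_orbit.measurable.aemeasurable

/-- The measure on the flag manifold is invariant under `SOₙ`. -/
theorem map_rotate_flagMeasure {n r : ℕ} (p : FlagType n r) (g : SO n) :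
    (flagMeasure p).map (fun ξ => ξ.rotate g) = flagMeasure p := by
  have hinv : (haarSO n).map (fun h => g * h) = haarSO n := by
    unfold haarSO
    exact map_mul_left_eq_self _ g
  unfold flagMeasure
  rw [Measure.map_map (Flag.continuous_rotate g).measurable
    (Flag.standard p).continuous_orbit.measurable]
  conv_rhs => rw [← hinv]
  rw [Measure.map_map (Flag.standard p).continuous_orbit.measurable
    (continuous_const_mul g).measurable]
  congr 1
  funext h
  exact (Flag.rotate_mul g h _).symm

/-! ### The flag quermassintegrals -/

/-- `|P_F L|`: the Lebesgue measure, in the Euclidean space `F`, of the orthogonal projection of `L`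
onto `F`. -/
noncomputable def projVol {n : ℕ} (F : Submodule ℝ (Euc n)) (L : Set (Euc n)) : ℝ≥0∞ :=
  (volume : Measure F) (F.orthogonalProjectionOnto '' L)

/-- `|L ∩ F|`: the Lebesgue measure, in the Euclidean space `F`, of the section of `L` by `F`. -/
noncomputable def sectVol {n : ℕ} (F : Submodule ℝ (Euc n)) (L : Set (Euc n)) : ℝ≥0∞ :=
  (volume : Measure F) {x : F | (x : Euc n) ∈ L}

/-- The flag quermassintegral
`Φ(L) = (∫ ∏_{j=1}^r |P_{F_j} L| ^ (i_{j-1} - i_{j+1}) dξ) ^ (-1 / (i_r n))`, with values in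
`[0, ∞]`, where `0⁻¹ = ∞` and `∞⁻¹ = 0`. In the product, `j : Fin r` stands for the
index `j + 1` of the formula. -/
noncomputable def Phi {n r : ℕ} (p : FlagType n r) (L : Set (Euc n)) : ℝ≥0∞ :=
  (∫⁻ ξ : Flag p, ∏ j : Fin r,
    projVol (ξ.space j) L ^ ((p.seq j : ℤ) - (p.seq (j + 2) : ℤ)) ∂flagMeasure p) ^
      (-(1 / ((p.seq r : ℝ) * (n : ℝ))))

/-- The dual flag quermassintegral
`Ψ(L) = (∫ ∏_{j=1}^r |L ∩ F_j| ^ (i_{j+1} - i_{j-1}) dξ) ^ (1 / (i_r n))`, with the same indexing. -/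
noncomputable def Psi {n r : ℕ} (p : FlagType n r) (L : Set (Euc n)) : ℝ≥0∞ :=
  (∫⁻ ξ : Flag p, ∏ j : Fin r,
    sectVol (ξ.space j) L ^ ((p.seq (j + 2) : ℤ) - (p.seq j : ℤ)) ∂flagMeasure p) ^
      (1 / ((p.seq r : ℝ) * (n : ℝ)))

end FlagQuermass

namespace FlagQuermass

/-! Both integrals pull back to `SO n` along `k ↦ k • standard flag`, and the integrands become
restrictions to rotations of functions `h` on all matrices (`sectProd`, `shadowProd`): sections and
shadows measured in the coordinates that the matrix `g` provides. Right multiplication by an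
invertible matrix of the parabolic group `P` fixing the standard flag multiplies `h` by the
character `flagChar`. Transforming `L` multiplies the argument on the left by a matrix `t` with
`|det t| = 1`: an inverse for sections, a transpose for shadows, where translations do not matter.
So it suffices that `∫ h (t k) dk = ∫ h k dk` over the rotations (`lintegral_SO_flagChar`).

This is the classical fact that functions transforming by the modular character of `P` are densities
on `G / P`, whose integral is invariant under `G`. The exponents `i_{j+1} - i_{j-1}` are exactly
what makes `flagChar`, up to a power of `|det|`, this character (`FlagType.prod_modular`,
`flagChar_modular`); the power of `|det|` is `1` on every matrix `t k`.

The fact is proved in `lintegral_SO_comp_mul_left` by Lebesgue integration over matrices instead of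
a quotient measure. For rotation invariant `u`, `w`, Fubini exchanges an average of `u` over `P`
with a weighted average of `w` (`lintegral_mul_avgMul`). By `g = k q` with `k` a rotation and `q`
upper triangular, both averages are constant on invertible matrices. Hence `∫ h (t g) w g dg` is a
constant multiple of `∫ h g u g dg`, with a constant free of `t`. It is also a constant multiple of
`∫ h (t k) dk` (`lintegral_mul_rotInvariant`). The integral of `h` may be infinite; only constants
known to be positive and finite are cancelled. -/

/-- Square matrices of size `n`. -/
abbrev Mat (n : ℕ) : Type := Matrix (Fin n) (Fin n) ℝ

/-! ### Lebesgue measure on matrices under left and right multiplication -/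

noncomputable instance (n : ℕ) : MeasureSpace (Mat n) :=
  inferInstanceAs (MeasureSpace (Fin n → Fin n → ℝ))

instance (n : ℕ) : BorelSpace (Mat n) :=
  inferInstanceAs (BorelSpace (Fin n → Fin n → ℝ))

instance (n : ℕ) : SecondCountableTopology (Mat n) :=
  inferInstanceAs (SecondCountableTopology (Fin n → Fin n → ℝ))

instance (n : ℕ) : SFinite (volume : Measure (Mat n)) :=
  inferInstanceAs (SFinite (volume : Measure (Fin n → Fin n → ℝ)))

theorem lintegral_comp_linearMap {E : Type*} [NormedAddCommGroup E] [NormedSpace ℝ E]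
    [MeasurableSpace E] [BorelSpace E] [FiniteDimensional ℝ E] (μ : Measure E)
    [μ.IsAddHaarMeasure] {f : E →ₗ[ℝ] E} (hf : LinearMap.det f ≠ 0) {F : E → ℝ≥0∞}
    (hF : Measurable F) :
    ENNReal.ofReal |LinearMap.det f| * ∫⁻ x, F (f x) ∂μ = ∫⁻ x, F x ∂μ := by
  have hfm : Measurable f := (LinearMap.continuous_of_finiteDimensional f).measurable
  rw [← lintegral_map hF hfm, Measure.map_linearMap_addHaar_eq_smul_addHaar μ hf,
    lintegral_smul_measure, smul_eq_mul, ← mul_assoc, ← ENNReal.ofReal_mul (abs_nonneg _),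
    ← abs_mul, mul_inv_cancel₀ hf]
  simp

/-- Right multiplication by `p`, row by row. -/
noncomputable def mulRightPi {n : ℕ} (p : Mat n) : (Fin n → Fin n → ℝ) →ₗ[ℝ] (Fin n → Fin n → ℝ) :=
  LinearMap.pi fun i => (Matrix.toLin' p.transpose).comp (LinearMap.proj i)

theorem det_mulRightPi {n : ℕ} (p : Mat n) : LinearMap.det (mulRightPi p) = p.det ^ n := by
  rw [mulRightPi, LinearMap.det_pi]
  simp

theorem mulRightPi_apply {n : ℕ} (p g : Mat n) : mulRightPi p g = g * p := by
  ext i j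
  change (p.transpose.mulVec (g i)) j = _
  simp [Matrix.mulVec, Matrix.mul_apply, dotProduct, mul_comm]

theorem lintegral_mul_right {n : ℕ} {p : Mat n} (hp : p.det ≠ 0) {F : Mat n → ℝ≥0∞}
    (hF : Measurable F) :
    ENNReal.ofReal |p.det| ^ n * ∫⁻ g, F (g * p) = ∫⁻ g, F g := by
  have h := lintegral_comp_linearMap (volume : Measure (Fin n → Fin n → ℝ)) (f := mulRightPi p)
    (by rw [det_mulRightPi]; exact pow_ne_zero _ hp) (F := F) hF
  rw [det_mulRightPi, abs_pow, ENNReal.ofReal_pow (abs_nonneg _)] at h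
  refine Eq.trans ?_ h
  congr 1
  exact lintegral_congr fun g => congrArg F (mulRightPi_apply p g).symm

/-- Transposition conjugates left multiplication by `t` into right multiplication by its transpose.
-/
theorem det_mulLeft_pi {n : ℕ} (t : Mat n) (f : (Fin n → Fin n → ℝ) →ₗ[ℝ] (Fin n → Fin n → ℝ))
    (hf : ∀ g : Mat n, f g = t * g) : LinearMap.det f = t.det ^ n := by
  let e : (Fin n → Fin n → ℝ) ≃ₗ[ℝ] (Fin n → Fin n → ℝ) :=
    Matrix.transposeLinearEquiv (Fin n) (Fin n) ℝ ℝ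
  have : f = (e : _ →ₗ[ℝ] _) ∘ₗ mulRightPi t.transpose ∘ₗ (e.symm : _ →ₗ[ℝ] _) := by
    apply LinearMap.ext
    intro g
    have h (g : Mat n) : t * g = (g.transpose * t.transpose).transpose := by
      rw [Matrix.transpose_mul, Matrix.transpose_transpose, Matrix.transpose_transpose]
    exact (hf g).trans ((h g).trans
      (congrArg Matrix.transpose (mulRightPi_apply t.transpose (Matrix.transpose g)).symm))
  rw [this, LinearMap.det_conj, det_mulRightPi, Matrix.det_transpose]

theorem lintegral_mul_left {n : ℕ} {t : Mat n} (ht : |t.det| = 1) {F : Mat n → ℝ≥0∞}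
    (hF : Measurable F) : ∫⁻ g, F (t * g) = ∫⁻ g, F g := by
  let f : (Fin n → Fin n → ℝ) →ₗ[ℝ] (Fin n → Fin n → ℝ) :=
    (LinearMap.mulLeft ℝ t : Mat n →ₗ[ℝ] Mat n)
  have hd : LinearMap.det f = t.det ^ n := det_mulLeft_pi t f fun g => rfl
  have h0 : t.det ≠ 0 := fun h => by simp [h] at ht
  have h := lintegral_comp_linearMap (volume : Measure (Fin n → Fin n → ℝ)) (f := f)
    (by rw [hd]; exact pow_ne_zero _ h0) (F := F) hF
  rw [hd, abs_pow, ht, one_pow, ENNReal.ofReal_one, one_mul] at h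
  exact h

/-! ### Block triangular matrices -/

/-- Positions of the entries of a block upper triangular matrix. -/
abbrev BlockPos {n : ℕ} (b : Fin n → ℕ) : Type := {s : Fin n × Fin n // b s.1 ≤ b s.2}

/-- The block triangular matrix with given entries. -/
def toMat {n : ℕ} (b : Fin n → ℕ) : (BlockPos b → ℝ) →ₗ[ℝ] Mat n where
  toFun x := Matrix.of fun a c => if h : b a ≤ b c then x ⟨(a, c), h⟩ else 0
  map_add' x y := by
    ext a c
    by_cases h : b a ≤ b c <;> simp [h]
  map_smul' r x := by
    ext a c
    by_cases h : b a ≤ b c <;> simp [h]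

/-- The entries of a matrix at the block triangular positions. -/
def ofMat {n : ℕ} (b : Fin n → ℕ) : Mat n →ₗ[ℝ] (BlockPos b → ℝ) where
  toFun M s := M s.1.1 s.1.2
  map_add' _ _ := rfl
  map_smul' _ _ := rfl

section BlockTriangularMatrices

variable {n : ℕ} {b : Fin n → ℕ}

theorem toMat_blockTriangular (x : BlockPos b → ℝ) : (toMat b x).BlockTriangular b := by
  intro i j hij
  simp [toMat, not_le.2 hij]

theorem toMat_ofMat {M : Mat n} (hM : M.BlockTriangular b) : toMat b (ofMat b M) = M := by
  ext i j
  by_cases h : b i ≤ b j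
  · simp [toMat, h]
    rfl
  · simp [toMat, h, hM (not_le.1 h)]

theorem ofMat_toMat (x : BlockPos b → ℝ) : ofMat b (toMat b x) = x := by
  funext s
  have : b s.1.1 ≤ b s.1.2 := s.2
  change toMat b x s.1.1 s.1.2 = _
  simp [toMat, this]

/-- Right multiplication on block triangular matrices. -/
def blockMulRight (b : Fin n → ℕ) (p : Mat n) : (BlockPos b → ℝ) →ₗ[ℝ] (BlockPos b → ℝ) :=
  ofMat b ∘ₗ LinearMap.mulRight ℝ p ∘ₗ toMat b

/-- Left multiplication on block triangular matrices. -/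
def blockMulLeft (b : Fin n → ℕ) (p : Mat n) : (BlockPos b → ℝ) →ₗ[ℝ] (BlockPos b → ℝ) :=
  ofMat b ∘ₗ LinearMap.mulLeft ℝ p ∘ₗ toMat b

theorem toMat_blockMulRight {p : Mat n} (hp : p.BlockTriangular b) (x : BlockPos b → ℝ) :
    toMat b (blockMulRight b p x) = toMat b x * p :=
  toMat_ofMat ((toMat_blockTriangular x).mul hp)

theorem toMat_blockMulLeft {p : Mat n} (hp : p.BlockTriangular b) (x : BlockPos b → ℝ) :
    toMat b (blockMulLeft b p x) = p * toMat b x :=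
  toMat_ofMat (hp.mul (toMat_blockTriangular x))

theorem blockMulRight_mul {p : Mat n} (hp : p.BlockTriangular b) (q : Mat n) :
    blockMulRight b (p * q) = blockMulRight b q ∘ₗ blockMulRight b p := by
  ext1 s
  ext1
  change ofMat b (toMat b _ * (p * q)) = ofMat b (toMat b (blockMulRight b p _) * q)
  rw [toMat_blockMulRight hp, Matrix.mul_assoc]

theorem blockMulRight_one : blockMulRight b 1 = LinearMap.id := by
  refine LinearMap.ext fun x => ?_
  change ofMat b (toMat b x * 1) = x
  rw [Matrix.mul_one, ofMat_toMat]

theorem det_blockMulRight_mul {p : Mat n} (hp : p.BlockTriangular b) (q : Mat n) :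
    LinearMap.det (blockMulRight b (p * q)) =
      LinearMap.det (blockMulRight b p) * LinearMap.det (blockMulRight b q) := by
  rw [blockMulRight_mul hp, LinearMap.det_comp, mul_comm]

theorem blockTriangular_inv {p : Mat n} (hp : p.BlockTriangular b) (h : p.det ≠ 0) :
    (p⁻¹).BlockTriangular b := by
  have : Invertible p := p.invertibleOfIsUnitDet (isUnit_iff_ne_zero.2 h)
  exact Matrix.blockTriangular_inv_of_blockTriangular hp

theorem det_blockMulRight_mul_inv {p : Mat n} (hp : p.BlockTriangular b) (h : p.det ≠ 0) :
    LinearMap.det (blockMulRight b p) * LinearMap.det (blockMulRight b p⁻¹) = 1 := by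
  rw [← det_blockMulRight_mul hp, Matrix.mul_nonsing_inv _ (isUnit_iff_ne_zero.2 h),
    blockMulRight_one, LinearMap.det_id]

theorem det_blockMulRight_ne_zero {p : Mat n} (hp : p.BlockTriangular b) (h : p.det ≠ 0) :
    LinearMap.det (blockMulRight b p) ≠ 0 :=
  left_ne_zero_of_mul_eq_one (det_blockMulRight_mul_inv hp h)

theorem continuous_toMat : Continuous (toMat b) := by
  refine continuous_pi fun i => continuous_pi fun j => ?_
  by_cases h : b i ≤ b j
  · simpa [toMat, h] using continuous_apply (A := fun _ : BlockPos b => ℝ) ⟨(i, j), h⟩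
  · simpa [toMat, h] using continuous_const

theorem toMat_single (s : BlockPos b) (r : ℝ) :
    toMat b (Pi.single s r) = Matrix.single s.1.1 s.1.2 r := by
  ext i j
  by_cases h : b i ≤ b j
  · by_cases e : s = ⟨(i, j), h⟩
    · subst e
      simp [toMat, h]
    · have : ¬ (s.1.1 = i ∧ s.1.2 = j) := by
        rintro ⟨h1, h2⟩
        exact e (Subtype.ext (Prod.ext h1 h2))
      simp [toMat, h, this, Pi.single_apply, Ne.symm e]
  · have : ¬ (s.1.1 = i ∧ s.1.2 = j) := by
      rintro ⟨rfl, rfl⟩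
      exact h s.2
    simp [toMat, h, this]

theorem toMatrix_blockMulRight (p : Mat n) (s s' : BlockPos b) :
    LinearMap.toMatrix' (blockMulRight b p) s s' =
      if s'.1.1 = s.1.1 then p s'.1.2 s.1.2 else 0 := by
  rw [LinearMap.toMatrix'_apply]
  change (toMat b (Pi.single s' 1) * p) s.1.1 s.1.2 = _
  rw [toMat_single]
  split_ifs with h
  · rw [← h]; simp
  · simp [Matrix.mul_apply, h]

theorem toMatrix_blockMulLeft (p : Mat n) (s s' : BlockPos b) :
    LinearMap.toMatrix' (blockMulLeft b p) s s' = if s'.1.2 = s.1.2 then p s.1.1 s'.1.1 else 0 := by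
  rw [LinearMap.toMatrix'_apply]
  change (p * toMat b (Pi.single s' 1)) s.1.1 s.1.2 = _
  rw [toMat_single]
  split_ifs with h
  · rw [← h]; simp
  · simp [Matrix.mul_apply, h]

/-- Right multiplication acts within each row, so in the lexicographic order on positions its matrix
is triangular, and only the diagonal of `q` matters. -/
theorem det_blockMulRight {q : Mat n} (hq : q.BlockTriangular id) :
    LinearMap.det (blockMulRight b q) = ∏ s : BlockPos b, q s.1.2 s.1.2 := by
  let _ : LinearOrder (BlockPos b) :=
    LinearOrder.lift' (fun s => toLex s.1) (toLex.injective.comp Subtype.val_injective)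
  rw [← LinearMap.det_toMatrix', Matrix.det_of_isLowerTriangular]
  · exact Finset.prod_congr rfl fun s _ => by rw [toMatrix_blockMulRight, if_pos rfl]
  · intro s s' hs
    rw [toMatrix_blockMulRight]
    split_ifs with h
    · have hlt : toLex s.1 < toLex s'.1 := hs
      rcases Prod.Lex.lt_iff.1 hlt with h1 | h1
      · exact absurd h h1.ne'
      · exact hq h1.2
    · rfl

/-- Now columns are preserved and rows mix; in the same order the matrix is upper instead of lower
triangular. -/
theorem det_blockMulLeft {q : Mat n} (hq : q.BlockTriangular id) :
    LinearMap.det (blockMulLeft b q) = ∏ s : BlockPos b, q s.1.1 s.1.1 := by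
  let _ : LinearOrder (BlockPos b) :=
    LinearOrder.lift' (fun s => toLex s.1) (toLex.injective.comp Subtype.val_injective)
  rw [← LinearMap.det_toMatrix', Matrix.det_of_isUpperTriangular]
  · exact Finset.prod_congr rfl fun s _ => by rw [toMatrix_blockMulLeft, if_pos rfl]
  · intro s s' hs
    rw [toMatrix_blockMulLeft]
    split_ifs with h
    · have hlt : toLex s'.1 < toLex s.1 := hs
      rcases Prod.Lex.lt_iff.1 hlt with h1 | h1
      · exact hq h1
      · exact absurd h h1.2.ne
    · rfl

theorem continuous_det_blockMulRight :
    Continuous fun p : Mat n => LinearMap.det (blockMulRight b p) := by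
  simp_rw [← LinearMap.det_toMatrix']
  refine Continuous.matrix_det ?_
  refine continuous_pi fun s => continuous_pi fun s' => ?_
  simp_rw [toMatrix_blockMulRight]
  split_ifs
  · fun_prop
  · fun_prop

/-! ### The factorization of invertible matrices -/

/-- Gram–Schmidt on the columns, completed to an orthonormal basis, so that singular matrices are
covered too. -/
theorem exists_orthogonal_mul_upperTriangular {n : ℕ} (g : Mat n) :
    ∃ k ∈ Matrix.orthogonalGroup (Fin n) ℝ, ∃ q : Mat n, q.BlockTriangular id ∧ g = k * q := by
  let e := EuclideanSpace.basisFun (Fin n) ℝ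
  let f : Fin n → Euc n := fun j => WithLp.toLp 2 (g.col j)
  have hc : Module.finrank ℝ (Euc n) = Fintype.card (Fin n) := by simp
  let e' := InnerProductSpace.gramSchmidtOrthonormalBasis hc f
  refine ⟨e.toBasis.toMatrix e', e.toMatrix_orthonormalBasis_mem_orthogonal e',
    e'.toBasis.toMatrix f, InnerProductSpace.gramSchmidtOrthonormalBasis_inv_isUpperTriangular hc f,
    ?_⟩
  have h := e.toBasis.toMatrix_mul_toMatrix e'.toBasis f
  rw [e'.coe_toBasis] at h
  rw [h]
  ext i j
  simp [Module.Basis.toMatrix_apply, e, f]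

theorem exists_SO_mul_upperTriangular {n : ℕ} {g : Mat n} (hg : g.det ≠ 0) :
    ∃ (k : SO n) (q : Mat n), q.BlockTriangular id ∧ q.det ≠ 0 ∧ g = k * q := by
  obtain ⟨k, hk, q, hq, rfl⟩ := exists_orthogonal_mul_upperTriangular g
  rw [Matrix.det_mul] at hg
  have hk2 : k.det * k.det = 1 := by
    have := congrArg Matrix.det ((Matrix.mem_orthogonalGroup_iff _ _).1 hk)
    simpa using this
  rcases Nat.eq_zero_or_pos n with rfl | hn
  · exact ⟨⟨k, (Matrix.mem_specialOrthogonalGroup_iff).2 ⟨hk, by simp⟩⟩, q, hq,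
      right_ne_zero_of_mul hg, rfl⟩
  -- A diagonal sign matrix of determinant `det k = ±1`: an involution that can be moved from the
  -- orthogonal factor to the triangular one.
  · let v : Fin n → ℝ := Function.update 1 ⟨0, hn⟩ k.det
    have hv : ∀ i, v i * v i = 1 := by
      intro i
      by_cases hi : i = ⟨0, hn⟩
      · subst hi; simpa [v] using hk2
      · simp [v, hi]
    have hdv : (Matrix.diagonal v).det = k.det := by
      rw [Matrix.det_diagonal, Finset.prod_update_of_mem (Finset.mem_univ _)]
      simp
    have hDD : Matrix.diagonal v * Matrix.diagonal v = (1 : Mat n) := by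
      rw [Matrix.diagonal_mul_diagonal, ← Matrix.diagonal_one]
      congr 1
      funext i
      exact hv i
    have hD : Matrix.diagonal v ∈ Matrix.orthogonalGroup (Fin n) ℝ := by
      rw [Matrix.mem_orthogonalGroup_iff]
      simpa using hDD
    refine ⟨⟨k * Matrix.diagonal v, Matrix.mem_specialOrthogonalGroup_iff.2
      ⟨mul_mem hk hD, by rw [Matrix.det_mul, hdv, hk2]⟩⟩, Matrix.diagonal v * q,
      (Matrix.blockTriangular_diagonal v).mul hq, ?_, ?_⟩
    · rw [Matrix.det_mul, hdv]
      exact hg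
    · change k * q = k * Matrix.diagonal v * (Matrix.diagonal v * q)
      rw [Matrix.mul_assoc, ← Matrix.mul_assoc (Matrix.diagonal v), hDD, Matrix.one_mul]

/-! ### Rotations, Haar measure and measurability of matrix operations -/

theorem SO_transpose_mul {n : ℕ} (k : SO n) :
    (k : Mat n).transpose * (k : Mat n) = 1 :=
  (Matrix.mem_orthogonalGroup_iff' _ _).1 (Matrix.mem_specialOrthogonalGroup_iff.1 k.2).1

theorem SO_det {n : ℕ} (k : SO n) : (k : Mat n).det = 1 :=
  (Matrix.mem_specialOrthogonalGroup_iff.1 k.2).2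

theorem measurable_coe_SO {n : ℕ} : Measurable fun k : SO n => (k : Mat n) :=
  continuous_subtype_val.measurable

instance (n : ℕ) : (haarSO n).IsHaarMeasure := by
  unfold haarSO; infer_instance

theorem continuousAt_inv_of_det_ne_zero {n : ℕ} {g : Mat n} (hg : g.det ≠ 0) :
    ContinuousAt (fun g : Mat n => g⁻¹) g := by
  simp only [Matrix.inv_def, Ring.inverse_eq_inv']
  exact ((Continuous.matrix_det continuous_id).continuousAt.inv₀ hg).smul
    (Continuous.matrix_adjugate continuous_id).continuousAt

theorem measurable_matrix_inv {n : ℕ} : Measurable (fun g : Mat n => g⁻¹) := by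
  refine measurable_pi_iff.2 fun i => measurable_pi_iff.2 fun j => ?_
  simp only [Matrix.inv_def, Ring.inverse_eq_inv', Matrix.smul_apply, smul_eq_mul]
  exact (Continuous.matrix_det continuous_id).measurable.inv.mul
    ((Continuous.matrix_adjugate continuous_id).matrix_elem i j).measurable

instance {n : ℕ} : MeasurableMul₂ (Mat n) :=
  ⟨(continuous_fst.matrix_mul continuous_snd).measurable⟩

/-- A right translate is again a Haar probability measure, hence the same one by uniqueness. -/
instance (n : ℕ) : (haarSO n).IsMulRightInvariant where
  map_mul_right_eq_self g := by
    have : IsProbabilityMeasure ((haarSO n).map (· * g)) :=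
      Measure.isProbabilityMeasure_map (measurable_mul_const g).aemeasurable
    exact Measure.isHaarMeasure_eq_of_isProbabilityMeasure _ _

/-! ### Averaging over the block triangular group -/

/-- `h` transforms by `χ` under right multiplication by invertible block triangular matrices. -/
def Equivariant (b : Fin n → ℕ) (χ h : Mat n → ℝ≥0∞) : Prop :=
  ∀ g p : Mat n, p.BlockTriangular b → p.det ≠ 0 → h (g * p) = χ p * h g

/-- Invariance under left multiplication by rotations. -/
def RotInvariant (u : Mat n → ℝ≥0∞) : Prop :=
  ∀ (k : SO n) (g : Mat n), u (k * g) = u g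

theorem blockTriangular_of_id (hb : Monotone b) {q : Mat n} (hq : q.BlockTriangular id) :
    q.BlockTriangular b :=
  fun _ _ h => hq (hb.reflect_lt h)

theorem Equivariant.comp_mul_left {χ h : Mat n → ℝ≥0∞} (hh : Equivariant b χ h) (t : Mat n) :
    Equivariant b χ fun g => h (t * g) := fun g p hp hd => by
  simp only [← Matrix.mul_assoc, hh _ p hp hd]

/-- The modulus of right multiplication on block triangular matrices. -/
noncomputable def rightModulus (b : Fin n → ℕ) (p : Mat n) : ℝ≥0∞ :=
  ENNReal.ofReal |LinearMap.det (blockMulRight b p)|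

theorem rightModulus_mul {p : Mat n} (hp : p.BlockTriangular b) (q : Mat n) :
    rightModulus b (p * q) = rightModulus b p * rightModulus b q := by
  rw [rightModulus, det_blockMulRight_mul hp, abs_mul, ENNReal.ofReal_mul (abs_nonneg _)]
  rfl

theorem rightModulus_ne_top (p : Mat n) : rightModulus b p ≠ ∞ := ENNReal.ofReal_ne_top

theorem rightModulus_ne_zero {p : Mat n} (hp : p.BlockTriangular b) (h : p.det ≠ 0) :
    rightModulus b p ≠ 0 := by
  simpa [rightModulus] using det_blockMulRight_ne_zero hp h

theorem continuous_rightModulus : Continuous (rightModulus b) :=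
  ENNReal.continuous_ofReal.comp continuous_det_blockMulRight.abs

theorem measurable_det : Measurable fun g : Mat n => g.det :=
  (Continuous.matrix_det continuous_id).measurable

theorem measurableSet_det_ne_zero : MeasurableSet {g : Mat n | g.det ≠ 0} :=
  (measurable_det (measurableSet_singleton 0)).compl

theorem measurableSet_det_toMat_ne_zero :
    MeasurableSet {x : BlockPos b → ℝ | (toMat b x).det ≠ 0} :=
  continuous_toMat.measurable measurableSet_det_ne_zero

/-- The average of `p ↦ u (g p⁻¹)` with respect to the right Haar measure of the block triangular
group. -/
noncomputable def avgInv (b : Fin n → ℕ) (u : Mat n → ℝ≥0∞) (g : Mat n) : ℝ≥0∞ :=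
  ∫⁻ x in {x : BlockPos b → ℝ | (toMat b x).det ≠ 0},
    u (g * (toMat b x)⁻¹) * (rightModulus b (toMat b x))⁻¹

/-- The average of `p ↦ v (g p)` with respect to the right Haar measure of the block triangular
group, weighted by `χ` and the Jacobian of right multiplication on all matrices. -/
noncomputable def avgMul (b : Fin n → ℕ) (χ v : Mat n → ℝ≥0∞) (g : Mat n) : ℝ≥0∞ :=
  ∫⁻ x in {x : BlockPos b → ℝ | (toMat b x).det ≠ 0},
    v (g * toMat b x) * (χ (toMat b x) * ENNReal.ofReal |(toMat b x).det| ^ n *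
      (rightModulus b (toMat b x))⁻¹)

theorem measurable_avgInv_kernel {u : Mat n → ℝ≥0∞} (hu : Measurable u) :
    Measurable fun z : Mat n × (BlockPos b → ℝ) =>
      u (z.1 * (toMat b z.2)⁻¹) * (rightModulus b (toMat b z.2))⁻¹ := by
  have h2 : Measurable fun z : Mat n × (BlockPos b → ℝ) => toMat b z.2 :=
    continuous_toMat.measurable.comp measurable_snd
  exact (hu.comp (measurable_fst.mul (measurable_matrix_inv.comp h2))).mul
    (continuous_rightModulus.measurable.comp h2).inv

theorem measurable_avgMul_kernel {χ v : Mat n → ℝ≥0∞} (hχ : Measurable χ) (hv : Measurable v) :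
    Measurable fun z : Mat n × (BlockPos b → ℝ) =>
      v (z.1 * toMat b z.2) * (χ (toMat b z.2) * ENNReal.ofReal |(toMat b z.2).det| ^ n *
      (rightModulus b (toMat b z.2))⁻¹) := by
  have h2 : Measurable fun z : Mat n × (BlockPos b → ℝ) => toMat b z.2 :=
    continuous_toMat.measurable.comp measurable_snd
  refine (hv.comp (measurable_fst.mul h2)).mul (((hχ.comp h2).mul ?_).mul
    (continuous_rightModulus.measurable.comp h2).inv)
  exact ((continuous_abs.measurable.comp (measurable_det.comp h2)).ennreal_ofReal).pow_const n

theorem measurable_avgInv {u : Mat n → ℝ≥0∞} (hu : Measurable u) : Measurable (avgInv b u) :=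
  Measurable.lintegral_prod_right' (measurable_avgInv_kernel hu)

/-- Substitute `x ↦ x q`: then `(g q) (x q)⁻¹ = g x⁻¹`, and the Jacobian cancels the factor by which
the modulus changes. -/
theorem avgInv_mul_right {u : Mat n → ℝ≥0∞} (hu : Measurable u) {q : Mat n}
    (hq : q.BlockTriangular b) (hd : q.det ≠ 0) (g : Mat n) :
    avgInv b u (g * q) = avgInv b u g := by
  have hm := ((measurable_avgInv_kernel (b := b) hu).comp
    (measurable_prodMk_left (x := g * q))).indicator measurableSet_det_toMat_ne_zero
  have h := lintegral_comp_linearMap (volume : Measure (BlockPos b → ℝ))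
    (det_blockMulRight_ne_zero hq hd) hm
  rw [lintegral_indicator measurableSet_det_toMat_ne_zero] at h
  refine h.symm.trans ?_
  rw [avgInv, ← lintegral_indicator measurableSet_det_toMat_ne_zero,
    ← lintegral_const_mul' _ _ ENNReal.ofReal_ne_top]
  refine lintegral_congr fun x => ?_
  by_cases hx : (toMat b x).det = 0
  · rw [Set.indicator_of_notMem, Set.indicator_of_notMem, mul_zero]
    · simpa using hx
    · simp [toMat_blockMulRight hq, hx]
  · rw [Set.indicator_of_mem, Set.indicator_of_mem]
    rotate_left
    · simpa using hx
    · simp [toMat_blockMulRight hq, hx, hd]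
    simp only [Function.comp_apply]
    rw [toMat_blockMulRight hq, rightModulus_mul (toMat_blockTriangular x), Matrix.mul_inv_rev,
      Matrix.mul_assoc, Matrix.mul_nonsing_inv_cancel_left _ _ (isUnit_iff_ne_zero.2 hd),
      ENNReal.mul_inv (Or.inr (rightModulus_ne_top _)) (Or.inr (rightModulus_ne_zero hq hd))]
    change rightModulus b q * _ = _
    calc _ = u (g * (toMat b x)⁻¹) * (rightModulus b (toMat b x))⁻¹ *
          (rightModulus b q * (rightModulus b q)⁻¹) := by ring
      _ = _ := by
        rw [ENNReal.mul_inv_cancel (rightModulus_ne_zero hq hd) (rightModulus_ne_top _), mul_one]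

/-- The substitution `x ↦ q x` acts on the side on which the underlying Haar measure need not be
invariant; `hmod` says that the weight compensates for this. Here the modular character enters. -/
theorem avgMul_mul_right {χ v : Mat n → ℝ≥0∞} (hχ : Measurable χ) (hv : Measurable v) {q : Mat n}
    (hq : q.BlockTriangular b) (hd : q.det ≠ 0)
    (hL : LinearMap.det (blockMulLeft b q) ≠ 0)
    (hχq : ∀ p : Mat n, p.BlockTriangular b → p.det ≠ 0 → χ (q * p) = χ q * χ p)
    (hmod : χ q * ENNReal.ofReal |q.det| ^ n *
      ENNReal.ofReal |LinearMap.det (blockMulLeft b q)| = rightModulus b q) (g : Mat n) :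
    avgMul b χ v (g * q) = avgMul b χ v g := by
  have hm := ((measurable_avgMul_kernel (b := b) hχ hv).comp
    (measurable_prodMk_left (x := g))).indicator measurableSet_det_toMat_ne_zero
  have h := lintegral_comp_linearMap (volume : Measure (BlockPos b → ℝ)) hL hm
  rw [lintegral_indicator measurableSet_det_toMat_ne_zero] at h
  refine Eq.trans ?_ h
  rw [avgMul, ← lintegral_indicator measurableSet_det_toMat_ne_zero,
    ← lintegral_const_mul' _ _ ENNReal.ofReal_ne_top]
  refine lintegral_congr fun x => ?_
  by_cases hx : (toMat b x).det = 0
  · rw [Set.indicator_of_notMem, Set.indicator_of_notMem, mul_zero]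
    · simp [toMat_blockMulLeft hq, hx]
    · simpa using hx
  · rw [Set.indicator_of_mem, Set.indicator_of_mem]
    rotate_left
    · simp [toMat_blockMulLeft hq, hx, hd]
    · simpa using hx
    simp only [Function.comp_apply]
    rw [toMat_blockMulLeft hq, rightModulus_mul hq, hχq _ (toMat_blockTriangular x) hx,
      Matrix.det_mul, abs_mul, ENNReal.ofReal_mul (abs_nonneg _), mul_pow, Matrix.mul_assoc,
      ENNReal.mul_inv (Or.inr (rightModulus_ne_top _))
        (Or.inr (rightModulus_ne_zero (toMat_blockTriangular x) hx))]
    symm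
    calc _ = v (g * (q * toMat b x)) * (χ (toMat b x) * ENNReal.ofReal |(toMat b x).det| ^ n *
            (rightModulus b (toMat b x))⁻¹) * ((χ q * ENNReal.ofReal |q.det| ^ n *
      ENNReal.ofReal |LinearMap.det (blockMulLeft b q)|) * (rightModulus b q)⁻¹) := by ring
      _ = _ := by
        rw [hmod, ENNReal.mul_inv_cancel (rightModulus_ne_zero hq hd) (rightModulus_ne_top _),
          mul_one]

/-- In `g = k q` the average absorbs `q` and the rotation invariance of `u` absorbs `k`. -/
theorem avgInv_eq_const (hb : Monotone b) {u : Mat n → ℝ≥0∞} (hu : Measurable u)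
    (hk : RotInvariant u) {g : Mat n} (hg : g.det ≠ 0) : avgInv b u g = avgInv b u 1 := by
  obtain ⟨k, q, hq, hd, rfl⟩ := exists_SO_mul_upperTriangular hg
  rw [avgInv_mul_right hu (blockTriangular_of_id hb hq) hd]
  refine lintegral_congr fun x => ?_
  rw [hk, Matrix.one_mul]

/-- The two averages are adjoint to each other. -/
theorem lintegral_mul_avgMul {χ h u v : Mat n → ℝ≥0∞} (hχ : Measurable χ) (hh : Measurable h)
    (hu : Measurable u) (hv : Measurable v) (he : Equivariant b χ h) :
    ∫⁻ g, h g * u g * avgMul b χ v g = ∫⁻ g, h g * v g * avgInv b u g := by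
  have hmu := measurable_avgInv_kernel (b := b) hu
  have hmv := measurable_avgMul_kernel (b := b) hχ hv
  have hl : ∀ g, h g * u g * avgMul b χ v g =
      ∫⁻ x in {x : BlockPos b → ℝ | (toMat b x).det ≠ 0}, h g * u g *
      (v (g * toMat b x) * (χ (toMat b x) * ENNReal.ofReal |(toMat b x).det| ^ n *
      (rightModulus b (toMat b x))⁻¹)) := fun g =>
    (lintegral_const_mul _ (hmv.comp (measurable_prodMk_left (x := g)))).symm
  have hr : ∀ g, h g * v g * avgInv b u g =
      ∫⁻ x in {x : BlockPos b → ℝ | (toMat b x).det ≠ 0}, h g * v g *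
      (u (g * (toMat b x)⁻¹) * (rightModulus b (toMat b x))⁻¹) := fun g =>
    (lintegral_const_mul _ (hmu.comp (measurable_prodMk_left (x := g)))).symm
  simp_rw [hl, hr]
  refine (lintegral_lintegral_swap
    (((hh.mul hu).comp measurable_fst).mul hmv).aemeasurable).trans (Eq.trans ?_
      (lintegral_lintegral_swap (((hh.mul hv).comp measurable_fst).mul hmu).aemeasurable).symm)
  refine setLIntegral_congr_fun measurableSet_det_toMat_ne_zero fun x hx => ?_
  have hF : Measurable fun g : Mat n =>
      h g * v g * (u (g * (toMat b x)⁻¹) * (rightModulus b (toMat b x))⁻¹) :=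
    (hh.mul hv).mul (hmu.comp (measurable_prodMk_right (y := x)))
  -- For fixed `x`, the substitution `g ↦ g x` gives the Jacobian `|det x| ^ n`, and `h` contributes
  -- `χ x`: together the weight in `avgMul`.
  rw [← lintegral_mul_right hx hF, ← lintegral_const_mul']
  · refine lintegral_congr fun g => ?_
    rw [he g _ (toMat_blockTriangular x) hx,
      Matrix.mul_nonsing_inv_cancel_right _ _ (isUnit_iff_ne_zero.2 hx)]
    ring
  · exact ENNReal.pow_ne_top ENNReal.ofReal_ne_top

theorem avgMul_comp_mul_left {χ v : Mat n → ℝ≥0∞} (t g : Mat n) :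
    avgMul b χ (fun g => v (t * g)) g = avgMul b χ v (t * g) := by
  simp only [avgMul, Matrix.mul_assoc]

theorem lintegral_SO_mul_right {χ h : Mat n → ℝ≥0∞} (hh : Measurable h)
    (he : Equivariant b χ h) {q : Mat n} (hq : q.BlockTriangular b) (hd : q.det ≠ 0) (k : SO n) :
    ∫⁻ k' : SO n, h (k' * (k * q)) ∂haarSO n = χ q * ∫⁻ k' : SO n, h k' ∂haarSO n := by
  rw [← lintegral_mul_right_eq_self (fun k' : SO n => h k') k,
    ← lintegral_const_mul (f := fun k' : SO n => h ((k' * k : SO n) : Mat n)) _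
      (hh.comp (measurable_coe_SO.comp (measurable_mul_const k)))]
  refine lintegral_congr fun k' => ?_
  rw [← Matrix.mul_assoc, he _ q hq hd]
  rfl

/-- Comparison of the integral over all matrices with the integral over the rotation group. -/
theorem lintegral_mul_rotInvariant (hb : Monotone b) {χ h h₀ w : Mat n → ℝ≥0∞}
    (hh : Measurable h) (hh₀ : Measurable h₀) (hw : Measurable w) (he : Equivariant b χ h)
    (he₀ : Equivariant b χ h₀) (hk₀ : RotInvariant h₀) (hk : RotInvariant w)
    (hw0 : ∀ g : Mat n, g.det = 0 → w g = 0) :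
    h₀ 1 * ∫⁻ g, h g * w g = (∫⁻ k : SO n, h k ∂haarSO n) * ∫⁻ g, h₀ g * w g := by
  have hm : Measurable fun z : Mat n × SO n => h (z.2 * z.1) * w z.1 :=
    (hh.comp ((measurable_coe_SO.comp measurable_snd).mul measurable_fst)).mul
      (hw.comp measurable_fst)
  -- Left rotations preserve Lebesgue measure and `w`, so `h` may be replaced by its rotation
  -- average.
  have h1 : ∫⁻ g, h g * w g = ∫⁻ g, (∫⁻ k : SO n, h (k * g) ∂haarSO n) * w g := by
    have h2 : ∀ g, (∫⁻ k : SO n, h (k * g) ∂haarSO n) * w g =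
        ∫⁻ k : SO n, h (k * g) * w g ∂haarSO n := fun g =>
      (lintegral_mul_const _ (hh.comp (measurable_coe_SO.mul_const g))).symm
    simp_rw [h2]
    rw [lintegral_lintegral_swap hm.aemeasurable]
    have h3 : ∀ k : SO n, ∫⁻ g, h (k * g) * w g = ∫⁻ g, h g * w g := fun k => by
      rw [← lintegral_mul_left (F := fun g => h g * w g) (t := (k : Mat n))
        (by rw [SO_det, abs_one]) (hh.mul hw)]
      exact lintegral_congr fun g => by rw [hk]
    simp_rw [h3]
    simp
  rw [h1, ← lintegral_const_mul, ← lintegral_const_mul (f := fun g => h₀ g * w g) _ (hh₀.mul hw)]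
  · refine lintegral_congr fun g => ?_
    by_cases hg : g.det = 0
    · simp [hw0 g hg]
    -- At `g = k q` the rotation average of `h` and the function `h₀` both reduce to `χ q` times a
    -- constant, so they are proportional.
    obtain ⟨k, q, hq, hd, rfl⟩ := exists_SO_mul_upperTriangular hg
    have hq' := blockTriangular_of_id hb hq
    rw [lintegral_SO_mul_right hh he hq' hd, hk₀, ← Matrix.one_mul q, he₀ 1 q hq' hd]
    simp only [Matrix.one_mul]
    ring
  · exact (Measurable.lintegral_prod_right' (f := fun z : Mat n × SO n => h (z.2 * z.1))
      (hh.comp ((measurable_coe_SO.comp measurable_snd).mul measurable_fst))).mul hw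

/-! ### A rotation invariant bounded neighbourhood of the identity -/

instance : (volume : Measure (Mat n)).IsOpenPosMeasure :=
  inferInstanceAs (volume : Measure (Fin n → Fin n → ℝ)).IsOpenPosMeasure

theorem trace_transpose_mul_self (g : Mat n) :
    (g.transpose * g).trace = ∑ j, ∑ i, g i j ^ 2 := by
  simp [Matrix.trace, Matrix.mul_apply, pow_two]

theorem isCompact_trace_le (C : ℝ) :
    IsCompact {g : Mat n | (g.transpose * g).trace ≤ C} := by
  have hK : IsCompact (Set.univ.pi fun _ : Fin n => Set.univ.pi fun _ : Fin n =>
      Metric.closedBall (0 : ℝ) (Real.sqrt C)) :=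
    isCompact_univ_pi fun _ => isCompact_univ_pi fun _ => isCompact_closedBall _ _
  refine IsCompact.of_isClosed_subset (X := Mat n) hK
    (isClosed_le (Continuous.matrix_trace (by fun_prop)) continuous_const) ?_
  intro g hg i _ j _
  rw [mem_closedBall_zero_iff, Real.norm_eq_abs]
  refine Real.abs_le_sqrt (le_trans ?_ hg)
  rw [trace_transpose_mul_self]
  calc g i j ^ 2 ≤ ∑ i, g i j ^ 2 :=
        Finset.single_le_sum (f := fun i => g i j ^ 2) (fun i _ => sq_nonneg _) (Finset.mem_univ i)
    _ ≤ _ := Finset.single_le_sum (f := fun j => ∑ i, g i j ^ 2)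
        (fun j _ => Finset.sum_nonneg fun i _ => sq_nonneg _) (Finset.mem_univ j)

theorem isCompact_trace_toMat_le (C : ℝ) :
    IsCompact {x : BlockPos b → ℝ | (toMat b x * (toMat b x).transpose).trace ≤ C} := by
  have hof : Continuous (ofMat b) := by
    refine continuous_pi fun s => ?_
    exact (continuous_apply s.1.2).comp (continuous_apply s.1.1)
  refine IsCompact.of_isClosed_subset ((isCompact_trace_le (n := n) C).image hof)
    (isClosed_le (Continuous.matrix_trace ((continuous_toMat.matrix_mul
      continuous_toMat.matrix_transpose))) continuous_const) ?_
  intro x hx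
  refine ⟨toMat b x, ?_, ofMat_toMat x⟩
  rw [Set.mem_ofPred_eq, Matrix.trace_mul_comm]
  exact hx

/-- A set of invertible matrices, invariant under rotations, on which matrices and their inverses
are bounded. -/
def boundedInvertible (n : ℕ) : Set (Mat n) :=
  {g | g.det ≠ 0 ∧ (g.transpose * g).trace ≤ n + 1 ∧ (g⁻¹ * g⁻¹.transpose).trace ≤ n + 1}

theorem measurableSet_boundedInvertible : MeasurableSet (boundedInvertible n) := by
  have ht : Measurable fun g : Mat n => (g.transpose * g).trace :=
    (Continuous.matrix_trace (by fun_prop)).measurable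
  have hc : Continuous fun g : Mat n => (g * g.transpose).trace :=
    Continuous.matrix_trace (by fun_prop)
  have hi : Measurable fun g : Mat n => (g⁻¹ * g⁻¹.transpose).trace :=
    hc.measurable.comp measurable_matrix_inv
  exact measurableSet_det_ne_zero.inter
    ((ht measurableSet_Iic).inter (hi measurableSet_Iic))

theorem rot_mul_mem_boundedInvertible (k : SO n) (g : Mat n) :
    (k : Mat n) * g ∈ boundedInvertible n ↔ g ∈ boundedInvertible n := by
  have hk := SO_transpose_mul k
  have hk' : (k : Mat n)⁻¹ = (k : Mat n).transpose := Matrix.inv_eq_left_inv hk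
  have h1 : ((k : Mat n) * g).transpose * (k * g) = g.transpose * g := by
    rw [Matrix.transpose_mul, Matrix.mul_assoc, ← Matrix.mul_assoc _ (k : Mat n), hk,
      Matrix.one_mul]
  have h2 : ((k : Mat n) * g)⁻¹ * (((k : Mat n) * g)⁻¹).transpose = g⁻¹ * g⁻¹.transpose := by
    rw [Matrix.mul_inv_rev, hk', Matrix.transpose_mul, Matrix.transpose_transpose,
      Matrix.mul_assoc, ← Matrix.mul_assoc _ (k : Mat n), hk, Matrix.one_mul]
  simp only [boundedInvertible, Set.mem_ofPred_eq, h1, h2, Matrix.det_mul, SO_det, one_mul]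

/-- The integrand lives on those `x` with `x⁻¹` in the set. There `x` is confined to a compact set
by the bound on inverses, and the inverse modulus of `x` is the modulus of `x⁻¹`, bounded by
compactness. -/
theorem avgInv_boundedInvertible_ne_top :
    avgInv b ((boundedInvertible n).indicator 1) 1 ≠ ∞ := by
  obtain ⟨B, hB⟩ : ∃ B : NNReal, ∀ g : Mat n, (g.transpose * g).trace ≤ n + 1 →
      rightModulus b g ≤ B := by
    have hc := (isCompact_trace_le (n := n) (n + 1)).bddAbove_image
      (f := fun g => |LinearMap.det (blockMulRight b g)|)
      continuous_det_blockMulRight.abs.continuousOn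
    obtain ⟨B, hB⟩ := hc
    exact ⟨B.toNNReal, fun g hg => ENNReal.ofReal_le_ofReal (hB ⟨g, hg, rfl⟩)⟩
  have hle : avgInv b ((boundedInvertible n).indicator 1) 1 ≤
      ∫⁻ _ in {x : BlockPos b → ℝ | (toMat b x * (toMat b x).transpose).trace ≤ n + 1},
        (B : ℝ≥0∞) := by
    rw [avgInv, ← lintegral_indicator measurableSet_det_toMat_ne_zero,
      ← lintegral_indicator (isCompact_trace_toMat_le _).measurableSet]
    refine lintegral_mono fun x => ?_
    by_cases hx : (toMat b x).det = 0
    · rw [Set.indicator_of_notMem (by simpa using hx)]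
      exact zero_le
    have hxS : x ∈ {x : BlockPos b → ℝ | (toMat b x).det ≠ 0} := hx
    rw [Set.indicator_of_mem hxS, Matrix.one_mul]
    by_cases hm : (toMat b x)⁻¹ ∈ boundedInvertible n
    · rw [Set.indicator_of_mem hm, Pi.one_apply, one_mul]
      obtain ⟨-, h1, h2⟩ := hm
      rw [Matrix.nonsing_inv_nonsing_inv _ (isUnit_iff_ne_zero.2 hx)] at h2
      have h2S : x ∈ {x : BlockPos b → ℝ |
        (toMat b x * (toMat b x).transpose).trace ≤ n + 1} := h2
      rw [Set.indicator_of_mem h2S]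
      refine le_trans (le_of_eq ?_) (hB _ h1)
      have hp := toMat_blockTriangular x
      have h := rightModulus_mul hp (toMat b x)⁻¹
      rw [Matrix.mul_nonsing_inv _ (isUnit_iff_ne_zero.2 hx)] at h
      rw [rightModulus, blockMulRight_one] at h
      simp only [LinearMap.det_id, abs_one, ENNReal.ofReal_one] at h
      exact (ENNReal.eq_inv_of_mul_eq_one_left (by rw [mul_comm]; exact h.symm)).symm
    · rw [Set.indicator_of_notMem hm, zero_mul]
      exact zero_le
  refine (hle.trans_lt ?_).ne
  rw [setLIntegral_const]
  exact ENNReal.mul_lt_top ENNReal.coe_lt_top (isCompact_trace_toMat_le _).measure_lt_top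

theorem det_inv_ne_zero {g : Mat n} (hg : g.det ≠ 0) : (g⁻¹).det ≠ 0 := by
  rw [Matrix.det_nonsing_inv, Ring.inverse_eq_inv']
  exact inv_ne_zero hg

/-- Both traces equal `n` at the identity, strictly below the bound `n + 1`. -/
theorem boundedInvertible_mem_nhds : boundedInvertible n ∈ nhds (1 : Mat n) := by
  have hi : ContinuousAt (fun g : Mat n => g⁻¹) 1 := continuousAt_inv_of_det_ne_zero (by simp)
  have hd : ∀ᶠ g in nhds (1 : Mat n), g.det ≠ 0 :=
    (Continuous.matrix_det continuous_id).continuousAt.eventually_ne (by simp)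
  have h1 : ∀ᶠ g in nhds (1 : Mat n), (g.transpose * g).trace < (n : ℝ) + 1 := by
    have hcont : Continuous fun g : Mat n => (g.transpose * g).trace :=
      Continuous.matrix_trace (by fun_prop)
    exact hcont.continuousAt.eventually_lt continuousAt_const (by simp)
  have h2 : ∀ᶠ g in nhds (1 : Mat n), (g⁻¹ * g⁻¹.transpose).trace < (n : ℝ) + 1 := by
    have hcont : Continuous fun g : Mat n => (g * g.transpose).trace :=
      Continuous.matrix_trace (by fun_prop)
    exact (hcont.continuousAt.comp hi).eventually_lt continuousAt_const (by simp)
  filter_upwards [hd, h1, h2] with g hg h1 h2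
  exact ⟨hg, h1.le, h2.le⟩

theorem avgInv_boundedInvertible_ne_zero :
    avgInv b ((boundedInvertible n).indicator 1) 1 ≠ 0 := by
  have h1 : toMat b (ofMat b 1) = 1 := toMat_ofMat Matrix.blockTriangular_one
  have hmem : {x : BlockPos b → ℝ | (toMat b x).det ≠ 0 ∧ (toMat b x)⁻¹ ∈ boundedInvertible n} ∈
      nhds (ofMat b (1 : Mat n)) := by
    have hc : ContinuousAt (toMat b) (ofMat b 1) := continuous_toMat.continuousAt
    have hd : ∀ᶠ x in nhds (ofMat b (1 : Mat n)), (toMat b x).det ≠ 0 := by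
      refine ((Continuous.matrix_det continuous_id).continuousAt.comp hc).eventually_ne ?_
      simp [h1]
    have hi : ContinuousAt (fun x => (toMat b x)⁻¹) (ofMat b 1) := by
      refine ContinuousAt.comp (g := fun g : Mat n => g⁻¹) ?_ hc
      rw [h1]
      exact continuousAt_inv_of_det_ne_zero (by simp)
    refine hd.and (hi.eventually_mem ?_)
    rw [h1, inv_one]
    exact boundedInvertible_mem_nhds
  intro h
  have hm := (measurable_avgInv_kernel (b := b) (u := (boundedInvertible n).indicator 1)
    (measurable_one.indicator measurableSet_boundedInvertible)).comp
    (measurable_prodMk_left (x := (1 : Mat n)))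
  rw [avgInv, ← lintegral_indicator measurableSet_det_toMat_ne_zero] at h
  have h0 := (lintegral_eq_zero_iff (hm.indicator measurableSet_det_toMat_ne_zero)).1 h
  have hpos := Measure.measure_pos_of_mem_nhds (volume : Measure (BlockPos b → ℝ)) hmem
  refine hpos.ne' (measure_mono_null ?_ h0)
  rintro x ⟨hx, hxm⟩
  change ¬ (_ = _)
  have hxS : x ∈ {x : BlockPos b → ℝ | (toMat b x).det ≠ 0} := hx
  rw [Set.indicator_of_mem hxS]
  simp [hxm, rightModulus_ne_top]

/-- **Invariance of the integral over the rotation group** of functions that transform by the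
modular character of the block triangular group. -/
theorem lintegral_SO_comp_mul_left (hb : Monotone b) {χ h h₀ : Mat n → ℝ≥0∞}
    (hχ : Measurable χ) (hh : Measurable h) (hh₀ : Measurable h₀)
    (he : Equivariant b χ h) (he₀ : Equivariant b χ h₀) (hk₀ : RotInvariant h₀)
    (h₀0 : h₀ 1 ≠ 0) (h₀t : h₀ 1 ≠ ∞)
    (hmod : ∀ q : Mat n, q.BlockTriangular id → q.det ≠ 0 → χ q * ENNReal.ofReal |q.det| ^ n *
      ENNReal.ofReal |LinearMap.det (blockMulLeft b q)| = rightModulus b q)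
    {t : Mat n} (ht : |t.det| = 1) :
    ∫⁻ k : SO n, h (t * k) ∂haarSO n = ∫⁻ k : SO n, h k ∂haarSO n := by
  -- The reference function determines `χ` as `h₀ p / h₀ 1`; multiplicativity of `χ` follows from
  -- this.
  have hχh : ∀ p : Mat n, p.BlockTriangular b → p.det ≠ 0 → h₀ p = χ p * h₀ 1 := fun p hp hd => by
    rw [← he₀ 1 p hp hd, Matrix.one_mul]
  have hχmul : ∀ q p : Mat n, q.BlockTriangular b → q.det ≠ 0 → p.BlockTriangular b →
      p.det ≠ 0 → χ (q * p) = χ q * χ p := fun q p hq hqd hp hpd => by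
    have h1 := he₀ q p hp hpd
    rw [hχh _ (hq.mul hp) (by rw [Matrix.det_mul]; exact mul_ne_zero hqd hpd), hχh q hq hqd,
      ← mul_assoc] at h1
    rw [(ENNReal.mul_left_inj h₀0 h₀t).1 h1, mul_comm]
  have hχone : χ 1 = 1 := by
    have h1 := hχh 1 Matrix.blockTriangular_one (by simp)
    exact ((ENNReal.mul_left_inj h₀0 h₀t).1 ((one_mul _).trans h1)).symm
  have hχinv : ∀ q : Mat n, q.BlockTriangular b → q.det ≠ 0 → χ q * χ q⁻¹ = 1 := fun q hq hd => by
    rw [← hχmul q q⁻¹ hq hd (blockTriangular_inv hq hd), Matrix.mul_nonsing_inv _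
      (isUnit_iff_ne_zero.2 hd), hχone]
    exact det_inv_ne_zero hd
  have hL : ∀ q : Mat n, q.BlockTriangular id → q.det ≠ 0 →
      LinearMap.det (blockMulLeft b q) ≠ 0 := fun q hq hd h => by
    have h1 := hmod q hq hd
    rw [h, abs_zero, ENNReal.ofReal_zero, mul_zero] at h1
    exact rightModulus_ne_zero (blockTriangular_of_id hb hq) hd h1.symm
  have h₀ne : ∀ g : Mat n, g.det ≠ 0 → h₀ g ≠ 0 ∧ h₀ g ≠ ∞ := fun g hg => by
    obtain ⟨k, q, hq, hd, rfl⟩ := exists_SO_mul_upperTriangular hg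
    have hq' := blockTriangular_of_id hb hq
    rw [hk₀, hχh q hq' hd]
    have h1 := hχinv q hq' hd
    refine ⟨mul_ne_zero (left_ne_zero_of_mul_eq_one h1) h₀0, ENNReal.mul_ne_top ?_ h₀t⟩
    intro h2
    have h3 : χ q⁻¹ ≠ 0 := right_ne_zero_of_mul_eq_one h1
    rw [h2, ENNReal.top_mul h3] at h1
    exact ENNReal.top_ne_one h1
  let u : Mat n → ℝ≥0∞ := (boundedInvertible n).indicator 1
  have hu : Measurable u := measurable_one.indicator measurableSet_boundedInvertible
  have hku : RotInvariant u := fun k g => by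
    by_cases hg : g ∈ boundedInvertible n
    · exact (Set.indicator_of_mem ((rot_mul_mem_boundedInvertible k g).2 hg) _).trans
        (Set.indicator_of_mem hg (1 : Mat n → ℝ≥0∞)).symm
    · exact (Set.indicator_of_notMem (mt (rot_mul_mem_boundedInvertible k g).1 hg) _).trans
        (Set.indicator_of_notMem hg _).symm
  have hu0 : ∀ g : Mat n, g.det = 0 → u g = 0 := fun g hg =>
    Set.indicator_of_notMem (fun h => h.1 hg) _
  -- Dividing by `h₀` turns the normalizing integral `∫ h₀ w` into the volume of `boundedInvertible
  -- n`, which is positive and finite.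
  let w : Mat n → ℝ≥0∞ := fun g => u g * (h₀ g)⁻¹
  have hw : Measurable w := hu.mul hh₀.inv
  have hkw : RotInvariant w := fun k g => by simp only [w, hku k g, hk₀ k g]
  have hw0 : ∀ g : Mat n, g.det = 0 → w g = 0 := fun g hg => by simp only [w, hu0 g hg, zero_mul]
  have hw1 : ∫⁻ g, h₀ g * w g = volume (boundedInvertible n) := by
    rw [← lintegral_indicator_one measurableSet_boundedInvertible]
    refine lintegral_congr fun g => ?_
    by_cases hg : g.det = 0
    · rw [hw0 g hg, mul_zero]
      exact (hu0 g hg).symm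
    · rw [mul_comm, mul_assoc, ENNReal.inv_mul_cancel (h₀ne g hg).1 (h₀ne g hg).2, mul_one]
  have hvt : volume (boundedInvertible n) ≠ ∞ :=
    ((measure_mono fun g hg => hg.2.1).trans_lt
      (IsCompact.measure_lt_top (μ := (volume : Measure (Fin n → Fin n → ℝ)))
        (isCompact_trace_le (n := n) (n + 1)))).ne
  have hv0 : volume (boundedInvertible n) ≠ 0 :=
    (Measure.measure_pos_of_mem_nhds volume
      boundedInvertible_mem_nhds).ne'
  -- The right-hand side does not contain `t`; comparing with `t = 1` gives the theorem.
  have key : ∀ t : Mat n, |t.det| = 1 →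
      avgInv b u 1 * ((∫⁻ k : SO n, h (t * k) ∂haarSO n) * volume (boundedInvertible n)) =
      h₀ 1 * ((∫⁻ g, h g * u g) * avgMul b χ w 1) := fun t ht => by
    have htd : t.det ≠ 0 := fun h => by simp [h] at ht
    have htu := isUnit_iff_ne_zero.2 htd
    have hti := det_inv_ne_zero htd
    have hht : Measurable fun g => h (t * g) := hh.comp (measurable_const_mul t)
    have hwt : Measurable fun g => w (t⁻¹ * g) := hw.comp (measurable_const_mul t⁻¹)
    rw [← hw1, ← lintegral_mul_rotInvariant hb hht hh₀ hw (he.comp_mul_left t) he₀ hk₀ hkw hw0,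
      mul_left_comm]
    congr 1
    have h1 := lintegral_mul_avgMul (b := b) hχ hh hu hwt he
    -- Substitute `g ↦ t g`, then pull out the average, constant on invertible matrices; `w`
    -- vanishes on the others.
    have h2 : ∫⁻ g, h g * w (t⁻¹ * g) * avgInv b u g =
        avgInv b u 1 * ∫⁻ g, h (t * g) * w g := by
      rw [← lintegral_const_mul (f := fun g => h (t * g) * w g) _ (hht.mul hw),
        ← lintegral_mul_left (F := fun g => h g * w (t⁻¹ * g) * avgInv b u g) ht
          ((hh.mul hwt).mul (measurable_avgInv hu))]
      refine lintegral_congr fun g => ?_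
      simp only [Matrix.nonsing_inv_mul_cancel_left _ _ htu]
      by_cases hg : g.det = 0
      · simp [hw0 g hg]
      · rw [avgInv_eq_const hb hu hku (by rw [Matrix.det_mul]; exact mul_ne_zero htd hg)]
        ring
    rw [← h2, ← h1, ← lintegral_mul_const (f := fun g => h g * u g) _ (hh.mul hu)]
    refine lintegral_congr fun g => ?_
    by_cases hg : g.det = 0
    · simp [hu0 g hg]
    rw [avgMul_comp_mul_left]
    -- The same factorization, applied to `t⁻¹ g`, shows that the weighted average of `w` is
    -- constant, which removes `t`.
    obtain ⟨k, q, hq, hd, e⟩ := exists_SO_mul_upperTriangular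
      (g := t⁻¹ * g) (by rw [Matrix.det_mul]; exact mul_ne_zero hti hg)
    have hq' := blockTriangular_of_id hb hq
    rw [e, avgMul_mul_right hχ hw hq' hd (hL q hq hd) (fun p hp hpd => hχmul q p hq' hd hp hpd)
      (hmod q hq hd)]
    congr 1
    refine lintegral_congr fun x => ?_
    rw [hkw, Matrix.one_mul]
  have h1 := key t ht
  rw [← key 1 (by simp), ENNReal.mul_right_inj avgInv_boundedInvertible_ne_zero
    avgInv_boundedInvertible_ne_top, ENNReal.mul_left_inj hv0 hvt] at h1
  simpa using h1

end BlockTriangularMatrices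

section FlagType

variable {n r : ℕ} (p : FlagType n r)

/-! ### The block structure attached to a flag type -/

theorem FlagType.seq_succ_of_lt {k : ℕ} (h : k < r) : p.seq (k + 1) = p.idx ⟨k, h⟩ := by
  simp [FlagType.seq, h]

theorem FlagType.seq_last : p.seq (r + 1) = n := by
  simp [FlagType.seq]

theorem FlagType.seq_le_succ (k : ℕ) (hk : k ≤ r) : p.seq k ≤ p.seq (k + 1) := by
  rcases k with _ | k
  · exact Nat.zero_le _
  · rw [p.seq_succ_of_lt hk]
    rcases Nat.lt_or_ge (k + 1) r with h | h
    · rw [p.seq_succ_of_lt h]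
      exact (p.strictMono (Fin.mk_lt_mk.2 k.lt_succ_self)).le
    · obtain rfl : k + 1 = r := le_antisymm hk h
      rw [p.seq_last]
      exact (p.lt _).le

theorem FlagType.seq_le (k : ℕ) (hk : k ≤ r) : p.seq k ≤ n := by
  rcases k with _ | k
  · exact Nat.zero_le _
  · rw [p.seq_succ_of_lt hk]
    exact (p.lt _).le

/-- The exponent `i_{j+1} - i_{j-1}`. -/
def FlagType.expo (j : ℕ) : ℕ := p.seq (j + 2) - p.seq j

/-- The number of the block that contains a given index. -/
def FlagType.blk (a : Fin n) : ℕ := (Finset.univ.filter fun j => p.idx j ≤ a).card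

theorem FlagType.monotone_blk : Monotone p.blk := fun _ _ h =>
  Finset.card_le_card (Finset.monotone_filter_right _ fun _ _ hj => hj.trans h)

theorem FlagType.blk_le (a : Fin n) : p.blk a ≤ r :=
  (Finset.card_le_univ _).trans_eq (Fintype.card_fin r)

/-- As `idx` increases, the indices counted by `blk` form an initial segment. Blocks are numbered
from `0`: block `k` is the range `seq k ≤ a < seq (k + 1)`. -/
theorem FlagType.lt_blk_iff (j : Fin r) (a : Fin n) : (j : ℕ) < p.blk a ↔ p.idx j ≤ a := by
  constructor
  · intro h
    by_contra hj
    refine absurd h (not_lt.2 ?_)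
    calc p.blk a ≤ (Finset.Iio j).card := by
          refine Finset.card_le_card fun j' hj' => ?_
          rw [Finset.mem_filter] at hj'
          rw [Finset.mem_Iio]
          exact p.strictMono.lt_iff_lt.1 (hj'.2.trans_lt (not_le.1 hj))
      _ = j := Fin.card_Iio j
  · intro h
    calc (j : ℕ) < (Finset.Iic j).card := by simp
      _ ≤ p.blk a := by
          refine Finset.card_le_card fun j' hj' => ?_
          rw [Finset.mem_Iic] at hj'
          exact Finset.mem_filter.2 ⟨Finset.mem_univ _, (p.strictMono.monotone hj').trans h⟩

theorem FlagType.card_blk_ge (a : Fin n) :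
    (Finset.univ.filter fun c => p.blk a ≤ p.blk c).card + p.seq (p.blk a) = n := by
  have h : (Finset.univ.filter fun c => p.blk a ≤ p.blk c) =
      (Finset.univ.filter fun c : Fin n => (c : ℕ) < p.seq (p.blk a))ᶜ := by
    ext c
    simp only [Finset.mem_filter, Finset.mem_univ, true_and, Finset.mem_compl, not_lt]
    have hr := p.blk_le a
    rcases hb : p.blk a with _ | k
    · simp [FlagType.seq]
    · rw [hb] at hr
      rw [p.seq_succ_of_lt hr, ← p.lt_blk_iff]
      rfl
  rw [h, Finset.card_compl, Fin.card_filter_val_lt, Fintype.card_fin,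
    min_eq_right (p.seq_le _ (p.blk_le a)), Nat.sub_add_cancel (p.seq_le _ (p.blk_le a))]

theorem FlagType.card_blk_le (a : Fin n) :
    (Finset.univ.filter fun c => p.blk c ≤ p.blk a).card = p.seq (p.blk a + 1) := by
  rcases Nat.lt_or_ge (p.blk a) r with h | h
  · have e : (Finset.univ.filter fun c => p.blk c ≤ p.blk a) =
        Finset.univ.filter fun c : Fin n => (c : ℕ) < p.seq (p.blk a + 1) := by
      ext c
      simp only [Finset.mem_filter, Finset.mem_univ, true_and]
      rw [p.seq_succ_of_lt h, ← not_le, ← p.lt_blk_iff, not_lt]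
    rw [e, Fin.card_filter_val_lt, min_eq_right]
    rw [p.seq_succ_of_lt h]
    exact (p.lt _).le
  · have e : p.blk a = r := le_antisymm (p.blk_le a) h
    rw [e, p.seq_last, Finset.filter_true_of_mem fun c _ => p.blk_le c]
    simp

/-- The exponent is a sum of two consecutive gaps of `seq`, so the sum telescopes. Moving terms
across avoids truncated subtraction. -/
theorem FlagType.sum_expo_Ico {k : ℕ} (hk : k ≤ r) :
    (∑ j ∈ Finset.Ico k r, p.expo j) + p.seq (k + 1) + p.seq k = n + p.seq r := by
  induction hk using Nat.decreasingInduction with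
  | self => simp [p.seq_last]
  | of_succ k hk ih =>
    rw [Finset.sum_eq_sum_Ico_succ_bot hk]
    have h1 := p.seq_le_succ k hk.le
    have h2 := p.seq_le_succ (k + 1) hk
    have : p.expo k = p.seq (k + 2) - p.seq k := rfl
    have e : k + 1 + 1 = k + 2 := rfl
    rw [e] at ih h2
    omega

theorem FlagType.sum_expo (a : Fin n) :
    (∑ j : Fin r, if (a : ℕ) < p.idx j then p.expo j else 0) + p.seq (p.blk a + 1) +
      p.seq (p.blk a) = n + p.seq r := by
  rw [← p.sum_expo_Ico (p.blk_le a)]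
  congr 2
  have h : ∀ j : Fin r, (if (a : ℕ) < p.idx j then p.expo j else 0) =
      (fun j => if p.blk a ≤ j then p.expo j else 0) (j : ℕ) := by
    intro j
    have : (a : ℕ) < p.idx j ↔ p.blk a ≤ j := by
      rw [← not_le, ← p.lt_blk_iff, not_lt]
    simp [this]
  rw [Finset.sum_congr rfl fun j _ => h j, Fin.sum_univ_eq_sum_range
    (fun j => if p.blk a ≤ j then p.expo j else 0) r, ← Finset.sum_filter]
  congr 1
  ext j
  simp [and_comm]

/-- Compare the powers of each `y a`: with `k = blk a` the claim is `(n - seq k) + seq r = seq (k +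
1) + ∑ expo`, the sum over the `j` with `a < idx j`. This is where the exponents of the
quermassintegrals are forced. -/
theorem FlagType.prod_modular (y : Fin n → ℝ) :
    (∏ s : BlockPos p.blk, y s.1.1) * (∏ a, y a) ^ p.seq r =
      (∏ s : BlockPos p.blk, y s.1.2) *
        ∏ j : Fin r, (∏ a : {a : Fin n // (a : ℕ) < p.idx j}, y a) ^ p.expo j := by
  have h1 : ∏ s : BlockPos p.blk, y s.1.1 =
      ∏ a, y a ^ (Finset.univ.filter fun c => p.blk a ≤ p.blk c).card := by
    rw [← Finset.prod_subtype (Finset.univ.filter fun s : Fin n × Fin n => p.blk s.1 ≤ p.blk s.2)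
      (by simp) (fun s => y s.1), Finset.prod_filter, Fintype.prod_prod_type]
    refine Finset.prod_congr rfl fun a _ => ?_
    rw [← Finset.prod_filter]
    exact Finset.prod_const (y a)
  have h2 : ∏ s : BlockPos p.blk, y s.1.2 =
      ∏ a, y a ^ (Finset.univ.filter fun c => p.blk c ≤ p.blk a).card := by
    rw [← Finset.prod_subtype (Finset.univ.filter fun s : Fin n × Fin n => p.blk s.1 ≤ p.blk s.2)
      (by simp) (fun s => y s.2), Finset.prod_filter, Fintype.prod_prod_type_right]
    refine Finset.prod_congr rfl fun a _ => ?_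
    rw [← Finset.prod_filter]
    exact Finset.prod_const (y a)
  have h3 : ∏ j : Fin r, (∏ a : {a : Fin n // (a : ℕ) < p.idx j}, y a) ^ p.expo j =
      ∏ a, y a ^ (∑ j : Fin r, if (a : ℕ) < p.idx j then p.expo j else 0) := by
    simp_rw [← Finset.prod_pow_eq_pow_sum]
    rw [Finset.prod_comm]
    refine Finset.prod_congr rfl fun j _ => ?_
    rw [← Finset.prod_subtype (Finset.univ.filter fun a : Fin n => (a : ℕ) < p.idx j)
      (by simp) y, ← Finset.prod_pow, Finset.prod_filter]
    refine Finset.prod_congr rfl fun a _ => ?_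
    split_ifs <;> simp
  rw [h1, h2, h3, ← Finset.prod_pow, ← Finset.prod_mul_distrib, ← Finset.prod_mul_distrib]
  refine Finset.prod_congr rfl fun a _ => ?_
  rw [← pow_add, ← pow_add, p.card_blk_le]
  congr 1
  have e1 := p.card_blk_ge a
  have e2 := p.sum_expo a
  omega

/-! ### Leading blocks -/

/-- Indices of the first `m` coordinates. -/
abbrev Lead (n m : ℕ) : Type := {a : Fin n // (a : ℕ) < m}

/-- The leading `m × m` block of a matrix. -/
def lead (m : ℕ) (g : Mat n) : Matrix (Lead n m) (Lead n m) ℝ :=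
  g.submatrix Subtype.val Subtype.val

/-- The absolute value of the leading minor of size `m`. -/
noncomputable def leadMinor (m : ℕ) (g : Mat n) : ℝ≥0∞ := ENNReal.ofReal |(lead m g).det|

/-- Extension by zero of the first `m` coordinates. -/
def extend (n m : ℕ) : (Lead n m → ℝ) →ₗ[ℝ] (Fin n → ℝ) where
  toFun y a := if h : (a : ℕ) < m then y ⟨a, h⟩ else 0
  map_add' x y := by
    ext a
    by_cases h : (a : ℕ) < m <;> simp [h]
  map_smul' c y := by
    ext a
    by_cases h : (a : ℕ) < m <;> simp [h]

/-- Restriction to the first `m` coordinates. -/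
def restrict (n m : ℕ) : (Fin n → ℝ) →ₗ[ℝ] (Lead n m → ℝ) := LinearMap.funLeft ℝ ℝ Subtype.val

theorem sum_eq_sum_lead (m : ℕ) (f : Fin n → ℝ) (hf : ∀ a : Fin n, ¬(a : ℕ) < m → f a = 0) :
    ∑ a, f a = ∑ a : Lead n m, f a := by
  rw [← Finset.sum_subtype (Finset.univ.filter fun a : Fin n => (a : ℕ) < m) (by simp) f,
    Finset.sum_filter]
  refine Finset.sum_congr rfl fun a _ => ?_
  split_ifs with h
  · rfl
  · exact hf a h

theorem mulVec_extend (m : ℕ) (g : Mat n) (y : Lead n m → ℝ) (i : Fin n) :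
    g.mulVec (extend n m y) i = ∑ a : Lead n m, g i a * y a := by
  refine (sum_eq_sum_lead m (fun a => g i a * extend n m y a) fun a ha => ?_).trans
    (Finset.sum_congr rfl fun a _ => ?_)
  · simp [extend, ha]
  · simp [extend, a.2]

/-- Block triangular matrices preserve the coordinate flag. -/
theorem apply_eq_zero_of_blockTriangular {g : Mat n} (hg : g.BlockTriangular p.blk) (j : Fin r)
    {a c : Fin n} (ha : ¬(a : ℕ) < p.idx j) (hc : (c : ℕ) < p.idx j) : g a c = 0 := by
  refine hg (lt_of_le_of_lt (b := (j : ℕ)) ?_ ?_)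
  · exact not_lt.1 fun h => (not_le.2 hc) ((p.lt_blk_iff j c).1 h)
  · exact (p.lt_blk_iff j a).2 (not_lt.1 ha)

theorem mulVec_extend_of_blockTriangular {g : Mat n} (hg : g.BlockTriangular p.blk) (j : Fin r)
    (y : Lead n (p.idx j) → ℝ) :
    g.mulVec (extend n _ y) = extend n _ ((lead (p.idx j) g).mulVec y) := by
  ext i
  rw [mulVec_extend]
  by_cases hi : (i : ℕ) < p.idx j
  · simp [extend, hi, lead, Matrix.mulVec, dotProduct]
  · rw [Finset.sum_eq_zero fun a _ => by
      rw [apply_eq_zero_of_blockTriangular p hg j hi a.2, zero_mul]]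
    simp [extend, hi]

theorem restrict_transpose_mulVec {g : Mat n} (hg : g.BlockTriangular p.blk) (j : Fin r)
    (x : Fin n → ℝ) :
    restrict n (p.idx j) (g.transpose.mulVec x) =
      (lead (p.idx j) g).transpose.mulVec (restrict n (p.idx j) x) := by
  ext c
  change ∑ a, g a c * x a = ∑ a : Lead n (p.idx j), g a c * x a
  refine sum_eq_sum_lead _ (fun a => g a c * x a) fun a ha => ?_
  rw [apply_eq_zero_of_blockTriangular p hg j ha c.2, zero_mul]

theorem extend_injective (m : ℕ) : Function.Injective (extend n m) := by
  intro x y h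
  ext a
  simpa [extend, a.2] using congrFun h a.1

/-- The leading block is the restriction of `g` to a coordinate subspace that `g` preserves, so it
inherits injectivity. -/
theorem det_lead_ne_zero {g : Mat n} (hg : g.BlockTriangular p.blk) (hd : g.det ≠ 0) (j : Fin r) :
    (lead (p.idx j) g).det ≠ 0 := by
  rw [← isUnit_iff_ne_zero, ← Matrix.isUnit_iff_isUnit_det, ← Matrix.mulVec_injective_iff_isUnit]
  intro x y h
  have h1 : g.mulVec (extend n _ x) = g.mulVec (extend n _ y) := by
    rw [mulVec_extend_of_blockTriangular p hg, mulVec_extend_of_blockTriangular p hg, h]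
  exact extend_injective _ (Matrix.mulVec_injective_iff_isUnit.2
    ((Matrix.isUnit_iff_isUnit_det _).2 (isUnit_iff_ne_zero.2 hd)) h1)

theorem det_lead_of_upperTriangular {q : Mat n} (hq : q.BlockTriangular id) (m : ℕ) :
    (lead m q).det = ∏ a : Lead n m, q a a :=
  Matrix.det_of_isUpperTriangular (M := lead m q) fun _ _ h => hq h

theorem measurable_leadMinor (m : ℕ) : Measurable (leadMinor (n := n) m) := by
  refine (Continuous.measurable ?_).ennreal_ofReal
  refine (Continuous.matrix_det ?_).abs
  exact continuous_id.matrix_submatrix _ _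

/-- The character by which the integrands of the flag quermassintegrals transform. -/
noncomputable def flagChar (g : Mat n) : ℝ≥0∞ :=
  ∏ j : Fin r, (leadMinor (p.idx j) g)⁻¹ ^ p.expo j

theorem measurable_flagChar : Measurable (flagChar p) :=
  Finset.measurable_prod _ fun _ _ => (measurable_leadMinor _).inv.pow_const _

/-- For triangular `q` every factor is a product of the `|q a a|`, and `FlagType.prod_modular`
applies. The power `n - i_r` leaves `|det q| ^ i_r` in total. -/
theorem flagChar_modular {q : Mat n} (hq : q.BlockTriangular id) (hd : q.det ≠ 0) :
    flagChar p q * (ENNReal.ofReal |q.det|)⁻¹ ^ (n - p.seq r) * ENNReal.ofReal |q.det| ^ n *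
      ENNReal.ofReal |LinearMap.det (blockMulLeft p.blk q)| = rightModulus p.blk q := by
  have hb := blockTriangular_of_id p.monotone_blk hq
  have hdet : |q.det| = ∏ a, |q a a| := by
    rw [Matrix.det_of_isUpperTriangular hq, Finset.abs_prod]
  have hmin : ∀ j, leadMinor (p.idx j) q =
      ENNReal.ofReal (∏ a : Lead n (p.idx j), |q a a|) := fun j => by
    rw [leadMinor, det_lead_of_upperTriangular hq, Finset.abs_prod]
  have hmod := congrArg ENNReal.ofReal (p.prod_modular fun a => |q a a|)
  have hnn : ∀ s : Finset (BlockPos p.blk), ∀ f : BlockPos p.blk → Fin n,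
    0 ≤ ∏ s ∈ s, |q (f s) (f s)| := fun s f => Finset.prod_nonneg fun _ _ => abs_nonneg _
  rw [ENNReal.ofReal_mul (hnn _ fun s => s.1.1), ENNReal.ofReal_mul (hnn _ fun s => s.1.2),
    ENNReal.ofReal_pow (Finset.prod_nonneg fun _ _ => abs_nonneg _), ← hdet,
    ENNReal.ofReal_prod_of_nonneg (fun _ _ => pow_nonneg
      (Finset.prod_nonneg fun _ _ => abs_nonneg _) _), ← Finset.abs_prod, ← Finset.abs_prod,
    ← det_blockMulLeft hq, ← det_blockMulRight hq] at hmod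
  have hpow : ∀ j : Fin r, ENNReal.ofReal
      ((∏ a : Lead n (p.idx j), |q a a|) ^ p.expo j) = leadMinor (p.idx j) q ^ p.expo j :=
    fun j => by rw [ENNReal.ofReal_pow (Finset.prod_nonneg fun _ _ => abs_nonneg _), hmin]
  rw [Finset.prod_congr rfl fun j _ => hpow j] at hmod
  have hcancel : flagChar p q * ∏ j : Fin r, leadMinor (p.idx j) q ^ p.expo j = 1 := by
    rw [flagChar, ← Finset.prod_mul_distrib]
    refine Finset.prod_eq_one fun j _ => ?_
    rw [← mul_pow, leadMinor, ENNReal.inv_mul_cancel _ ENNReal.ofReal_ne_top, one_pow]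
    simpa [leadMinor] using det_lead_ne_zero p hb hd j
  have hD : ENNReal.ofReal |q.det| ≠ 0 := by simpa using hd
  have hDn : (ENNReal.ofReal |q.det|)⁻¹ ^ (n - p.seq r) * ENNReal.ofReal |q.det| ^ n =
      ENNReal.ofReal |q.det| ^ p.seq r := by
    rw [← pow_sub_mul_pow (ENNReal.ofReal |q.det|) (p.seq_le r le_rfl), ← mul_assoc, ← mul_pow,
      ENNReal.inv_mul_cancel hD ENNReal.ofReal_ne_top, one_pow, one_mul]
  rw [mul_assoc (flagChar p q), hDn, mul_assoc, mul_comm (ENNReal.ofReal |q.det| ^ _), hmod,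
    mul_left_comm, hcancel, mul_one]
  rfl

/-! ### Sections and shadows as functions of a matrix -/

/-- The volume of the section of `L` by the image under `g` of the coordinate subspace spanned by
the first `m` basis vectors, measured in the coordinates that `g` provides. -/
noncomputable def sectFn (m : ℕ) (L : Set (Euc n)) (g : Mat n) : ℝ≥0∞ :=
  volume {y : Lead n m → ℝ | WithLp.toLp 2 (g.mulVec (extend n m y)) ∈ L}

/-- The volume of the projection of `gᵀ L` to the first `m` coordinates. -/
noncomputable def shadowFn (m : ℕ) (L : Set (Euc n)) (g : Mat n) : ℝ≥0∞ :=
  volume ((fun x : Euc n => restrict n m (g.transpose.mulVec x.ofLp)) '' L)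

theorem continuous_extend (m : ℕ) : Continuous (extend n m) :=
  LinearMap.continuous_of_finiteDimensional _

theorem continuous_restrict (m : ℕ) : Continuous (restrict n m) :=
  LinearMap.continuous_of_finiteDimensional _

theorem measurable_sectFn (m : ℕ) {L : Set (Euc n)} (hL : IsClosed L) :
    Measurable (sectFn m L) := by
  have hc : Continuous fun z : Mat n × (Lead n m → ℝ) =>
      WithLp.toLp 2 (z.1.mulVec (extend n m z.2)) :=
    (PiLp.continuous_toLp 2 _).comp
      (continuous_fst.matrix_mulVec ((continuous_extend m).comp continuous_snd))
  exact measurable_measure_prodMk_left (hL.preimage hc).measurableSet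

/-- The pairs of a matrix and a point of its shadow form the projection of a closed set along the
compact `L`, hence a closed set; its fibre measures are measurable. -/
theorem measurable_shadowFn (m : ℕ) {L : Set (Euc n)} (hL : IsCompact L) :
    Measurable (shadowFn m L) := by
  have : CompactSpace L := isCompact_iff_compactSpace.1 hL
  have hc : Continuous fun z : (Mat n × (Lead n m → ℝ)) × L =>
      restrict n m (z.1.1.transpose.mulVec z.2.1.ofLp) := by
    refine (continuous_restrict m).comp (Continuous.matrix_mulVec ?_ ?_)
    · exact (continuous_fst.comp continuous_fst).matrix_transpose
    · exact (PiLp.continuous_ofLp 2 _).comp (continuous_subtype_val.comp continuous_snd)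
  have hcl : IsClosed {z : (Mat n × (Lead n m → ℝ)) × L |
      restrict n m (z.1.1.transpose.mulVec z.2.1.ofLp) = z.1.2} :=
    isClosed_eq hc (continuous_snd.comp continuous_fst)
  have h := measurable_measure_prodMk_left (ν := (volume : Measure (Lead n m → ℝ)))
    (isClosedMap_fst_of_compactSpace _ hcl).measurableSet
  convert! h using 1
  funext g
  refine congrArg volume (Set.ext fun y => ⟨?_, ?_⟩)
  · rintro ⟨x, hx, rfl⟩
    exact ⟨((g, _), ⟨x, hx⟩), by rw [Set.mem_ofPred_eq], rfl⟩
  · rintro ⟨⟨⟨g', y'⟩, x⟩, h1, h2⟩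
    obtain ⟨rfl, rfl⟩ := Prod.mk.inj h2
    exact ⟨x.1, x.2, h1⟩

/-- On the coordinate subspace `q` acts by its leading block, so the two sections differ by a linear
preimage. -/
theorem sectFn_mul (j : Fin r) (L : Set (Euc n)) (g : Mat n) {q : Mat n}
    (hq : q.BlockTriangular p.blk) (hd : q.det ≠ 0) :
    sectFn (p.idx j) L (g * q) = (leadMinor (p.idx j) q)⁻¹ * sectFn (p.idx j) L g := by
  have hl := det_lead_ne_zero p hq hd j
  have h := Measure.addHaar_preimage_linearMap (volume : Measure (Lead n (p.idx j) → ℝ))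
    (f := Matrix.toLin' (lead (p.idx j) q)) (by rwa [LinearMap.det_toLin'])
    {y | WithLp.toLp 2 (g.mulVec (extend n _ y)) ∈ L}
  rw [LinearMap.det_toLin', abs_inv, ENNReal.ofReal_inv_of_pos (abs_pos.2 hl)] at h
  refine Eq.trans ?_ h
  rw [sectFn]
  congr 1
  ext y
  simp only [Set.mem_ofPred_eq, Set.mem_preimage, Matrix.toLin'_apply,
    ← mulVec_extend_of_blockTriangular p hq, Matrix.mulVec_mulVec]

/-- Dually, the shadow changes by a linear image under the transposed block. The factor is inverse
to that of sections, so the inverted shadows share their character. -/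
theorem shadowFn_mul (j : Fin r) (L : Set (Euc n)) (g : Mat n) {q : Mat n}
    (hq : q.BlockTriangular p.blk) :
    shadowFn (p.idx j) L (g * q) = leadMinor (p.idx j) q * shadowFn (p.idx j) L g := by
  have h := Measure.addHaar_image_linearMap (volume : Measure (Lead n (p.idx j) → ℝ))
    (Matrix.toLin' (lead (p.idx j) q).transpose)
    ((fun x : Euc n => restrict n _ (g.transpose.mulVec x.ofLp)) '' L)
  rw [LinearMap.det_toLin', Matrix.det_transpose, Set.image_image] at h
  refine Eq.trans ?_ h
  rw [shadowFn]
  congr 2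
  funext x
  rw [Matrix.toLin'_apply, ← restrict_transpose_mulVec p hq, Matrix.mulVec_mulVec,
    Matrix.transpose_mul]

/-- The integrand of the dual flag quermassintegral. -/
noncomputable def sectProd (L : Set (Euc n)) (g : Mat n) : ℝ≥0∞ :=
  ∏ j : Fin r, sectFn (p.idx j) L g ^ p.expo j

/-- The integrand of the flag quermassintegral. -/
noncomputable def shadowProd (L : Set (Euc n)) (g : Mat n) : ℝ≥0∞ :=
  ∏ j : Fin r, (shadowFn (p.idx j) L g)⁻¹ ^ p.expo j

theorem measurable_sectProd {L : Set (Euc n)} (hL : IsClosed L) : Measurable (sectProd p L) :=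
  Finset.measurable_prod _ fun _ _ => (measurable_sectFn _ hL).pow_const _

theorem measurable_shadowProd {L : Set (Euc n)} (hL : IsCompact L) :
    Measurable (shadowProd p L) :=
  Finset.measurable_prod _ fun _ _ => (measurable_shadowFn _ hL).inv.pow_const _

theorem equivariant_sectProd (L : Set (Euc n)) :
    Equivariant p.blk (flagChar p) (sectProd p L) := fun g q hq hd => by
  rw [sectProd, flagChar, sectProd, ← Finset.prod_mul_distrib]
  exact Finset.prod_congr rfl fun j _ => by rw [sectFn_mul p j L g hq hd, mul_pow]

theorem equivariant_shadowProd (L : Set (Euc n)) :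
    Equivariant p.blk (flagChar p) (shadowProd p L) := fun g q hq hd => by
  rw [shadowProd, flagChar, shadowProd, ← Finset.prod_mul_distrib]
  refine Finset.prod_congr rfl fun j _ => ?_
  rw [shadowFn_mul p j L g hq, ENNReal.mul_inv, mul_pow]
  · left
    simpa [leadMinor] using det_lead_ne_zero p hq hd j
  · exact Or.inl ENNReal.ofReal_ne_top

/-! ### The unit ball as reference body -/

theorem norm_rotMap (k : SO n) (x : Euc n) : ‖rotMap k x‖ = ‖x‖ := by
  rw [← sq_eq_sq₀ (norm_nonneg _) (norm_nonneg _), ← real_inner_self_eq_norm_sq,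
    ← real_inner_self_eq_norm_sq, inner_rotMap, rotMap_inv_apply]

theorem rotMap_toLp (k : SO n) (x : Fin n → ℝ) :
    rotMap k (WithLp.toLp 2 x) = WithLp.toLp 2 ((k : Mat n).mulVec x) :=
  Matrix.toEuclideanCLM_toLp _ _

theorem rotInvariant_sectProd_ball :
    RotInvariant (sectProd p (Metric.closedBall (0 : Euc n) 1)) := fun k g => by
  have h : ∀ x : Fin n → ℝ, ‖WithLp.toLp 2 ((k : Mat n).mulVec x)‖ = ‖WithLp.toLp 2 x‖ :=
    fun x => by
    rw [← rotMap_toLp, norm_rotMap]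
  simp only [sectProd, sectFn, mem_closedBall_zero_iff, ← Matrix.mulVec_mulVec, h]

theorem sectFn_ball_ne_zero (m : ℕ) : sectFn m (Metric.closedBall (0 : Euc n) 1) 1 ≠ 0 := by
  have hc : Continuous fun y : Lead n m → ℝ =>
      WithLp.toLp 2 ((1 : Mat n).mulVec (extend n m y)) :=
    (PiLp.continuous_toLp 2 _).comp
      (continuous_const.matrix_mulVec (continuous_extend m))
  refine (Measure.measure_pos_of_mem_nhds (x := 0) volume ?_).ne'
  refine hc.continuousAt.preimage_mem_nhds (Metric.closedBall_mem_nhds_of_mem ?_)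
  simp

theorem sectFn_ball_ne_top (m : ℕ) : sectFn m (Metric.closedBall (0 : Euc n) 1) 1 ≠ ∞ := by
  refine ((measure_mono ?_).trans_lt
    (isCompact_closedBall (0 : Lead n m → ℝ) 1).measure_lt_top).ne
  intro y hy
  rw [mem_closedBall_zero_iff, pi_norm_le_iff_of_nonneg zero_le_one]
  intro a
  have h := (PiLp.norm_apply_le (p := 2) (WithLp.toLp 2 (extend n m y)) a.1).trans
    (by simpa using hy)
  simpa [extend, a.2] using h

/-- **Invariance of the integral over the rotation group** for integrands that transform like
those of the flag quermassintegrals. -/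
theorem lintegral_SO_flagChar {h : Mat n → ℝ≥0∞} (hh : Measurable h)
    (he : Equivariant p.blk (flagChar p) h) {t : Mat n} (ht : |t.det| = 1) :
    ∫⁻ k : SO n, h (t * k) ∂haarSO n = ∫⁻ k : SO n, h k ∂haarSO n := by
  -- `flagChar` is the required character only after this twist by a power of `|det|`, which is `1`
  -- at `k` and at `t k`.
  let D : Mat n → ℝ≥0∞ := fun g => (ENNReal.ofReal |g.det|)⁻¹ ^ (n - p.seq r)
  have hD : Measurable D :=
    ((continuous_abs.measurable.comp measurable_det).ennreal_ofReal.inv).pow_const _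
  have hD1 : ∀ g : Mat n, |g.det| = 1 → D g = 1 := fun g hg => by simp [D, hg]
  have hDmul : ∀ g q : Mat n, q.det ≠ 0 → D (g * q) = D q * D g := fun g q hq => by
    simp only [D]
    rw [Matrix.det_mul, abs_mul, ENNReal.ofReal_mul (abs_nonneg _), ENNReal.mul_inv, mul_pow,
      mul_comm]
    · exact Or.inr ENNReal.ofReal_ne_top
    · right
      simpa using hq
  have heD : ∀ h : Mat n → ℝ≥0∞, Equivariant p.blk (flagChar p) h →
      Equivariant p.blk (fun g => flagChar p g * D g) fun g => h g * D g :=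
    fun h he g q hq hd => by
      simp only [he g q hq hd, hDmul g q hd]
      ring
  have h1 := lintegral_SO_comp_mul_left p.monotone_blk (h := fun g => h g * D g)
    (h₀ := fun g => sectProd p (Metric.closedBall (0 : Euc n) 1) g * D g)
    ((measurable_flagChar p).mul hD) (hh.mul hD)
    ((measurable_sectProd p Metric.isClosed_closedBall).mul hD)
    (heD _ he) (heD _ (equivariant_sectProd p _))
    (fun k g => by simp only [rotInvariant_sectProd_ball p k g, D, Matrix.det_mul, SO_det, one_mul])
    (by
      simp only [hD1 1 (by simp), mul_one, sectProd]
      exact Finset.prod_ne_zero_iff.2 fun j _ => pow_ne_zero _ (sectFn_ball_ne_zero _))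
    (by
      simp only [hD1 1 (by simp), mul_one, sectProd]
      exact ENNReal.prod_ne_top fun j _ => ENNReal.pow_ne_top (sectFn_ball_ne_top _))
    (fun q hq hd => flagChar_modular p hq hd) ht
  have hk : ∀ k : SO n, D k = 1 := fun k => hD1 k (by rw [SO_det, abs_one])
  have htk : ∀ k : SO n, D (t * k) = 1 := fun k =>
    hD1 _ (by rw [Matrix.det_mul, SO_det, mul_one, ht])
  simpa only [hk, htk, mul_one] using h1

end FlagType

variable {n r : ℕ}

/-! ### Sections and projections along the range of an isometry -/

section Isometry

variable {V : Type*} [NormedAddCommGroup V] [InnerProductSpace ℝ V] [FiniteDimensional ℝ V]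
  [MeasurableSpace V] [BorelSpace V]

theorem sectVol_range (f : V →ₗᵢ[ℝ] Euc n) (L : Set (Euc n)) :
    sectVol f.range L = volume {y : V | f y ∈ L} := by
  have h := f.equivRange.measurePreserving.measure_preimage_emb
    f.equivRange.toHomeomorph.measurableEmbedding {x : f.range | (x : Euc n) ∈ L}
  exact h.symm

/-- By `hP` the map `P` is the adjoint of the isometry `f`, so `f ∘ P` is the orthogonal projection
onto its range. -/
theorem projVol_range (f : V →ₗᵢ[ℝ] Euc n) (P : Euc n → V)
    (hP : ∀ x z, inner ℝ x (f z) = inner ℝ (P x) z) (L : Set (Euc n)) :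
    projVol f.range L = volume (P '' L) := by
  have h := f.equivRange.measurePreserving.measure_preimage_emb
    f.equivRange.toHomeomorph.measurableEmbedding (f.range.orthogonalProjectionOnto '' L)
  have hproj : ∀ x, f.range.orthogonalProjectionOnto x = f.equivRange (P x) := fun x => by
    refine Subtype.ext ?_
    rw [Submodule.coe_orthogonalProjectionOnto_apply]
    refine Submodule.eq_starProjection_of_mem_of_inner_eq_zero (f.equivRange (P x)).2 ?_
    rintro _ ⟨z, rfl⟩
    change inner ℝ (x - f (P x)) (f z) = 0
    rw [inner_sub_left, hP, f.inner_map_map, sub_self]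
  rw [projVol, ← h]
  congr 1
  ext y
  simp only [Set.mem_preimage, Set.mem_image, hproj, EmbeddingLike.apply_eq_iff_eq]

end Isometry

theorem norm_toLp_extend (m : ℕ) (y : Lead n m → ℝ) :
    ‖WithLp.toLp 2 (extend n m y)‖ = ‖WithLp.toLp 2 y‖ := by
  rw [EuclideanSpace.norm_eq, EuclideanSpace.norm_eq]
  congr 1
  rw [sum_eq_sum_lead m (fun a => ‖WithLp.toLp 2 (extend n m y) a‖ ^ 2) fun a ha => by
    simp [extend, ha]]
  exact Finset.sum_congr rfl fun a _ => by simp [extend, a.2]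

/-- The isometry of `ℝᵐ` onto the image under a rotation of the span of the first `m` basis
vectors. -/
noncomputable def frame (k : SO n) (m : ℕ) : EuclideanSpace ℝ (Lead n m) →ₗᵢ[ℝ] Euc n where
  toLinearMap := (rotMap k).toLinearMap ∘ₗ ((WithLp.linearEquiv 2 ℝ (Fin n → ℝ)).symm.toLinearMap ∘ₗ
    extend n m ∘ₗ (WithLp.linearEquiv 2 ℝ (Lead n m → ℝ)).toLinearMap)
  norm_map' y := (norm_rotMap k _).trans (norm_toLp_extend m y.ofLp)

theorem frame_apply (k : SO n) (m : ℕ) (y : EuclideanSpace ℝ (Lead n m)) :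
    frame k m y = WithLp.toLp 2 ((k : Mat n).mulVec (extend n m y.ofLp)) :=
  rotMap_toLp k _

theorem rotate_standard_space (p : FlagType n r) (k : SO n) (j : Fin r) :
    ((Flag.standard p).rotate k).space j = (frame k (p.idx j)).range := by
  change Submodule.map _ (Submodule.span ℝ _) = LinearMap.range (_ ∘ₗ _)
  rw [LinearMap.range_comp]
  congr 1
  rw [LinearMap.range_eq_map,
    ← (EuclideanSpace.basisFun (Lead n (p.idx j)) ℝ).toBasis.span_eq, Submodule.map_span,
    ← Set.range_comp]
  congr 2
  funext a
  ext i
  by_cases h : i = a.1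
  · subst h
    simp [extend, a.2]
  · by_cases h' : (i : ℕ) < p.idx j
    · have : (⟨i, h'⟩ : Lead n (p.idx j)) ≠ a := fun e => h (congrArg Subtype.val e)
      simp [extend, h, h', this]
    · simp [extend, h, h']

theorem sectVol_rotate_standard (p : FlagType n r) (k : SO n) (j : Fin r) (L : Set (Euc n)) :
    sectVol (((Flag.standard p).rotate k).space j) L = sectFn (p.idx j) L k := by
  rw [rotate_standard_space, sectVol_range, sectFn,
    ← (PiLp.volume_preserving_toLp (Lead n (p.idx j))).measure_preimage_emb
      (MeasurableEquiv.toLp 2 (Lead n (p.idx j) → ℝ)).measurableEmbedding]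
  simp only [frame_apply]
  rfl

theorem inner_frame (k : SO n) (m : ℕ) (x : Euc n) (z : EuclideanSpace ℝ (Lead n m)) :
    inner ℝ x (frame k m z) =
      inner ℝ (WithLp.toLp 2 (restrict n m ((k : Mat n).transpose.mulVec x.ofLp))) z := by
  rw [frame_apply, real_inner_comm, EuclideanSpace.inner_eq_star_dotProduct,
    EuclideanSpace.inner_eq_star_dotProduct]
  simp only [star_trivial]
  rw [Matrix.dotProduct_mulVec, ← Matrix.mulVec_transpose, dotProduct_comm]
  refine (sum_eq_sum_lead m (fun a => extend n m z.ofLp a * _) fun a ha => ?_).trans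
    (Finset.sum_congr rfl fun a _ => ?_)
  · simp [extend, ha]
  · simp [extend, a.2, restrict, LinearMap.funLeft]

theorem projVol_rotate_standard (p : FlagType n r) (k : SO n) (j : Fin r) (L : Set (Euc n)) :
    projVol (((Flag.standard p).rotate k).space j) L = shadowFn (p.idx j) L k := by
  rw [rotate_standard_space, projVol_range _ _ (inner_frame k (p.idx j)), shadowFn,
    ← (PiLp.volume_preserving_toLp (Lead n (p.idx j))).measure_preimage_emb
      (MeasurableEquiv.toLp 2 (Lead n (p.idx j) → ℝ)).measurableEmbedding]
  congr 1
  ext y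
  simp

/-! ### Integration over the flag manifold -/

instance (n : ℕ) : PolishSpace (SO n) := by
  have : PolishSpace (Matrix (Fin n) (Fin n) ℝ) :=
    inferInstanceAs (PolishSpace (Fin n → Fin n → ℝ))
  exact (isCompact_iff_compactSpace.2
    (inferInstanceAs (CompactSpace (SO n)))).isClosed.polishSpace

theorem Flag.isEmbedding_proj (p : FlagType n r) :
    Topology.IsEmbedding (Flag.proj (p := p)) := by
  refine ⟨⟨rfl⟩, fun ξ η h => ?_⟩
  ext j : 2
  exact Submodule.starProjection_inj.1 (congrFun h j)

/-- Measurability is assumed only after pulling back to `SO n`. It descends to the orbit, a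
measurable image of a Polish space, and the orbit is compact and carries the whole measure. -/
theorem lintegral_flagMeasure (p : FlagType n r) {F : Flag p → ℝ≥0∞}
    (hF : Measurable fun k : SO n => F ((Flag.standard p).rotate k)) :
    ∫⁻ ξ, F ξ ∂flagMeasure p = ∫⁻ k, F ((Flag.standard p).rotate k) ∂haarSO n := by
  have hc := (Flag.standard p).continuous_orbit
  have : T2Space (Flag p) := (Flag.isEmbedding_proj p).t2Space
  have : SecondCountableTopology (Flag p) :=
    (Flag.isEmbedding_proj p).toIsInducing.secondCountableTopology
  have hr : MeasurableSet (Set.range fun k : SO n => (Flag.standard p).rotate k) :=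
    (isCompact_range hc).isClosed.measurableSet
  have hres : (flagMeasure p).restrict (Set.range fun k : SO n => (Flag.standard p).rotate k) =
      flagMeasure p :=
    Measure.restrict_eq_self_of_ae_mem
      ((ae_map_iff hc.measurable.aemeasurable hr).2 (Filter.Eventually.of_forall fun k => ⟨k, rfl⟩))
  have hae : AEMeasurable F (flagMeasure p) := by
    rw [← hres]
    exact aemeasurable_restrict_of_measurable_subtype hr
      ((hc.measurable.measurable_comp_iff_restrict (g := F)).1 hF)
  exact lintegral_map' hae hc.measurable.aemeasurable

theorem FlagType.seq_le_add_two (p : FlagType n r) (j : Fin r) : p.seq j ≤ p.seq (j + 2) :=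
  (p.seq_le_succ j j.2.le).trans (p.seq_le_succ (j + 1) j.2)

theorem FlagType.coe_expo (p : FlagType n r) (j : Fin r) :
    (p.seq (j + 2) : ℤ) - (p.seq j : ℤ) = (p.expo j : ℕ) := by
  rw [FlagType.expo, Nat.cast_sub (p.seq_le_add_two j)]

theorem lintegral_sect (p : FlagType n r) {L : Set (Euc n)} (hL : IsClosed L) :
    ∫⁻ ξ : Flag p, ∏ j : Fin r,
      sectVol (ξ.space j) L ^ ((p.seq (j + 2) : ℤ) - (p.seq j : ℤ)) ∂flagMeasure p =
        ∫⁻ k : SO n, sectProd p L k ∂haarSO n := by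
  have h : ∀ k : SO n, ∏ j : Fin r, sectVol (((Flag.standard p).rotate k).space j) L ^
      ((p.seq (j + 2) : ℤ) - (p.seq j : ℤ)) = sectProd p L k := fun k =>
    Finset.prod_congr rfl fun j _ => by
      rw [p.coe_expo, zpow_natCast, sectVol_rotate_standard]
  rw [lintegral_flagMeasure]
  · simp only [h]
  · simp only [h]
    exact (measurable_sectProd p hL).comp measurable_coe_SO

theorem lintegral_proj (p : FlagType n r) {L : Set (Euc n)} (hL : IsCompact L) :
    ∫⁻ ξ : Flag p, ∏ j : Fin r,
      projVol (ξ.space j) L ^ ((p.seq j : ℤ) - (p.seq (j + 2) : ℤ)) ∂flagMeasure p =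
        ∫⁻ k : SO n, shadowProd p L k ∂haarSO n := by
  have h : ∀ k : SO n, ∏ j : Fin r, projVol (((Flag.standard p).rotate k).space j) L ^
      ((p.seq j : ℤ) - (p.seq (j + 2) : ℤ)) = shadowProd p L k := fun k =>
    Finset.prod_congr rfl fun j _ => by
      rw [← neg_sub, p.coe_expo, ENNReal.zpow_neg, zpow_natCast, projVol_rotate_standard,
        ENNReal.inv_pow]
  rw [lintegral_flagMeasure]
  · simp only [h]
  · simp only [h]
    exact (measurable_shadowProd p hL).comp measurable_coe_SO

/-! ### Affine maps -/

/-- After removing the translation, compare the volumes of the unit ball and of its image; a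
singular `t` would send the ball to a null set whose preimage contains the ball. -/
theorem abs_det_eq_one_of_measurePreserving (t : Mat n) (c : Euc n)
    (h : MeasurePreserving (fun x : Euc n => Matrix.toEuclideanLin t x + c) volume volume) :
    |t.det| = 1 := by
  have h1 : MeasurePreserving (Matrix.toEuclideanLin t : Euc n → Euc n) volume volume := by
    have := (measurePreserving_add_right (volume : Measure (Euc n)) (-c)).comp h
    convert! this using 1
    funext x
    simp
  have hdet : LinearMap.det (Matrix.toEuclideanLin t) = t.det := LinearMap.det_toLpLin 2 t
  let B : Set (Euc n) := Metric.closedBall 0 1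
  have hB : IsCompact B := isCompact_closedBall _ _
  have hB0 : volume B ≠ 0 := (Metric.measure_closedBall_pos volume 0 one_pos).ne'
  have hBt : volume B ≠ ∞ := hB.measure_lt_top.ne
  have himg :=
    Measure.addHaar_image_linearMap (volume : Measure (Euc n)) (Matrix.toEuclideanLin t) B
  rw [hdet] at himg
  have hpre := h1.measure_preimage ((hB.image
    (LinearMap.continuous_of_finiteDimensional
      (Matrix.toEuclideanLin t))).measurableSet.nullMeasurableSet)
  have ht : t.det ≠ 0 := by
    intro h0
    rw [h0, abs_zero, ENNReal.ofReal_zero, zero_mul] at himg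
    rw [himg] at hpre
    exact hB0 (measure_mono_null (Set.subset_preimage_image _ B) hpre)
  have hinj : Function.Injective (Matrix.toEuclideanLin t) :=
    ((Matrix.toEuclideanLin t).equivOfDetNeZero (by rwa [hdet])).injective
  rw [Set.preimage_image_eq _ hinj, himg] at hpre
  have := (ENNReal.mul_left_inj hB0 hBt).1 ((one_mul _).trans hpre)
  rw [eq_comm, ENNReal.ofReal_eq_one] at this
  exact this

/-- The translation only shifts the shadow, and `gᵀ t = (tᵀ g)ᵀ`. -/
theorem shadowFn_affine (m : ℕ) (L : Set (Euc n)) (t : Mat n) (c : Euc n) (g : Mat n) :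
    shadowFn m ((fun x : Euc n => Matrix.toEuclideanLin t x + c) '' L) g =
      shadowFn m L (t.transpose * g) := by
  rw [shadowFn, shadowFn, Set.image_image,
    ← measure_preimage_add_right volume (restrict n m (g.transpose.mulVec c.ofLp))]
  congr 1
  have h : ∀ x : Euc n, restrict n m (g.transpose.mulVec (Matrix.toEuclideanLin t x + c).ofLp) =
      restrict n m ((t.transpose * g).transpose.mulVec x.ofLp) +
        restrict n m (g.transpose.mulVec c.ofLp) := fun x => by
    rw [WithLp.ofLp_add, Matrix.ofLp_toLpLin, Matrix.toLin'_apply, Matrix.mulVec_add, map_add,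
      Matrix.mulVec_mulVec, Matrix.transpose_mul, Matrix.transpose_transpose]
  ext y
  simp only [Set.mem_preimage, Set.mem_image, h]
  refine exists_congr fun x => and_congr_right fun _ => ?_
  rw [add_left_inj]

theorem sectFn_linear (m : ℕ) (L : Set (Euc n)) {t : Mat n} (ht : t.det ≠ 0) (g : Mat n) :
    sectFn m (Matrix.toEuclideanLin t '' L) g = sectFn m L (t⁻¹ * g) := by
  rw [sectFn, sectFn]
  congr 1
  ext y
  have hu := isUnit_iff_ne_zero.2 ht
  simp only [Set.mem_ofPred_eq, Set.mem_image]
  constructor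
  · rintro ⟨x, hx, h⟩
    have h' := congrArg WithLp.ofLp h
    rw [Matrix.ofLp_toLpLin, Matrix.toLin'_apply] at h'
    rw [← Matrix.mulVec_mulVec, ← (show _ = g.mulVec (extend n m y) from h'),
      Matrix.mulVec_mulVec, Matrix.nonsing_inv_mul _ hu,
      Matrix.one_mulVec]
    exact hx
  · intro h
    refine ⟨_, h, ?_⟩
    rw [Matrix.toLpLin_toLp, Matrix.toLin'_apply, Matrix.mulVec_mulVec,
      Matrix.mul_nonsing_inv_cancel_left _ _ hu]

end FlagQuermass

/-! ### The main theorem -/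

theorem theorem1p1 (n r : ℕ) (hr : 1 ≤ r) (p : FlagQuermass.FlagType n r)
    (L : Set (EuclideanSpace ℝ (Fin n))) (hL : IsCompact L) :
    (∀ A : EuclideanSpace ℝ (Fin n) →ᵃ[ℝ] EuclideanSpace ℝ (Fin n),
        MeasurePreserving A volume volume →
          FlagQuermass.Phi p (A '' L) = FlagQuermass.Phi p L) ∧
      ∀ T : Matrix.SpecialLinearGroup (Fin n) ℝ,
        FlagQuermass.Psi p (Matrix.toEuclideanLin (T : Matrix (Fin n) (Fin n) ℝ) '' L) =
          FlagQuermass.Psi p L := by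
  open FlagQuermass in
  refine ⟨fun A hA => ?_, fun T => ?_⟩
  · let t : Mat n := Matrix.toEuclideanLin.symm A.linear
    have ht : Matrix.toEuclideanLin t = A.linear := LinearEquiv.apply_symm_apply _ _
    have hAt : (A : Euc n → Euc n) = fun x => Matrix.toEuclideanLin t x + A 0 := by
      rw [ht]
      exact AffineMap.decomp A
    have hdet : |t.transpose.det| = 1 := by
      rw [Matrix.det_transpose]
      exact abs_det_eq_one_of_measurePreserving t (A 0) (hAt ▸ hA)
    have hAL : IsCompact (A '' L) :=
      hL.image (AffineMap.continuous_of_finiteDimensional A)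
    rw [Phi, Phi, lintegral_proj p hAL, lintegral_proj p hL,
      ← lintegral_SO_flagChar p (measurable_shadowProd p hL) (equivariant_shadowProd p L) hdet, hAt]
    simp only [shadowProd, shadowFn_affine]
  · have hT : (T : Mat n).det = 1 := T.det_coe
    have hTL : IsCompact (Matrix.toEuclideanLin (T : Mat n) '' L) :=
      hL.image (LinearMap.continuous_of_finiteDimensional _)
    have hdet : |((T : Mat n)⁻¹).det| = 1 := by
      simp [Matrix.det_nonsing_inv, hT]
    rw [Psi, Psi, lintegral_sect p hTL.isClosed, lintegral_sect p hL.isClosed,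
      ← lintegral_SO_flagChar p (measurable_sectProd p hL.isClosed) (equivariant_sectProd p L) hdet]
    simp only [sectProd, sectFn_linear _ _ (show (T : Mat n).det ≠ 0 by simp)]
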